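/- Let $m\ge 1$ and let $\Omega\subset\mathbb{R}^m$ be a body, i.e. the closure of a non-empty bounded open set. Let $\sigma$ denote the surface measure on spheres, $S^{m-1}$ the unit sphere and $B_\varepsilon(x)$ the closed ball of radius $\varepsilon$ centered at $x$. The $r^{\alpha-m}$-potential $V_\Omega^{(\alpha)}$ is defined as follows. If $0<\alpha\neq m$, then $$V_\Omega^{(\alpha)}(x)=\operatorname{sign}(m-\alpha)\int_\Omega|x-y|^{\alpha-m}\,dy\quad(x\in\mathbb{R}^m),$$ and $V_\Omega^{(m)}(x)=-\int_\Omega\log|x-y|\,dy$. If $x$ is an interior point of $\Omega$, then $$V_\Omega^{(0)}(x)=\lim_{\varepsilon\to0^+}\Bigl(\int_{\Omega\setminus B_\varepsilon(x)}|x-y|^{-m}\,dy-\sigma(S^{m-1})\log\tfrac1\varepsilon\Bigr),$$ and, for $\alpha<0$, $$V_\Omega^{(\alpha)}(x)=\lim_{\varepsilon\to0^+}\Bigl(\int_{\Omega\setminus B_\varepsilon(x)}|x-y|^{\alpha-m}\,dy-\frac{\sigma(S^{m-1})}{-\alpha}\,\frac1{\varepsilon^{-\alpha}}\Bigr).$$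 A point $c$ is an $r^{\alpha-m}$-center of $\Omega$ if: for real $\alpha>0$, $c$ is a maximum point of $V_\Omega^{(\alpha)}$ on $\mathbb{R}^m$; for real $\alpha\le0$, $c$ is a maximum point of the restriction of $V_\Omega^{(\alpha)}$ to the interior of $\Omega$; for $\alpha=+\infty$, $c$ is a circumcenter of $\Omega$, i.e. a minimum point of $\mathbb{R}^m\ni x\mapsto\max_{y\in\Omega}|x-y|$. The centroid of $\Omega$ is $\frac{1}{\operatorname{Vol}(\Omega)}\int_\Omega y\,dy$. The body $\Omega$ satisfies the balance law at a point $x$ if $$\int_{rS^{m-1}\cap(\Omega-x)}v\,d\sigma(v)=0\quad\text{for every } r\ge0.$$ Suppose that $\Omega$ satisfies the balance law at a point $x$. Then: (1) If $m=1$ and $\alpha\in(2,+\infty]$, or if $m\ge2$ and $\alpha\in[m+1,+\infty]$, then $\Omega$ has a unique $r^{\alpha-m}$-center, and it is $x$. In particular, the centroid of $\Omega$ is $x$, and $x$ is the unique circumcenter of $\Omega$. (2) If $\Omega$ is convex, then, for every $\alpha\in(-\infty,1]\cup[m+1,+\infty]$, $\Omega$ has a unique $r^{\alpha-m}$-center,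 and it is $x$. -/

import Mathlib

noncomputable section

open MeasureTheory Metric Set Filter Topology

namespace RadialCenter

/-- The surface measure of the unit sphere of `ℝ^m` (the sphere `S^{m-1}`; for `m = 1` it is the
counting measure on `{-1, 1}`). -/
def unitSphereMeasure (m : ℕ) : Measure (sphere (0 : EuclideanSpace ℝ (Fin m)) 1) :=
  (volume : Measure (EuclideanSpace ℝ (Fin m))).toSphere

/-- The total surface area of the unit sphere `S^{m-1}`. -/
def sphereArea (m : ℕ) : ℝ := (unitSphereMeasure m).real univ

/-- The surface measure of the sphere `r S^{m-1}` of radius `r` centered at the origin, as a measure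
on `ℝ^m` carried by that sphere: the image of the surface measure of the unit sphere under
`v ↦ r v`, scaled by `r ^ (m - 1)`. -/
def sphereMeasure (m : ℕ) (r : ℝ) : Measure (EuclideanSpace ℝ (Fin m)) :=
  ENNReal.ofReal (r ^ (m - 1)) •
    (unitSphereMeasure m).map (fun v : sphere (0 : EuclideanSpace ℝ (Fin m)) 1 =>
      r • (v : EuclideanSpace ℝ (Fin m)))

/-- A body: the closure of a (nonempty) bounded open set. -/
def IsBody {m : ℕ} (Ω : Set (EuclideanSpace ℝ (Fin m))) : Prop :=
  ∃ U : Set (EuclideanSpace ℝ (Fin m)),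
    IsOpen U ∧ Bornology.IsBounded U ∧ U.Nonempty ∧ Ω = closure U

/-- The balance law for `Ω` at the point `x`:
the integral of `v` over `r S^{m-1} ∩ (Ω - x)` vanishes for every `r ≥ 0`. -/
def BalanceLaw {m : ℕ} (Ω : Set (EuclideanSpace ℝ (Fin m))) (x : EuclideanSpace ℝ (Fin m)) :
    Prop :=
  ∀ r : ℝ, 0 ≤ r → ∫ v in {v | x + v ∈ Ω}, v ∂(sphereMeasure m r) = 0

/-- The truncated integral of `|x - y| ^ (α - m)` over `Ω` outside the ball of radius `ε` around
`x`, minus its divergent part; its limit for `ε → 0+` is the Hadamard finite part (`α ≤ 0`). -/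
def truncated {m : ℕ} (Ω : Set (EuclideanSpace ℝ (Fin m))) (α : ℝ)
    (x : EuclideanSpace ℝ (Fin m)) (ε : ℝ) : ℝ :=
  (∫ y in Ω \ closedBall x ε, ‖x - y‖ ^ (α - m)) -
    (if α = 0 then sphereArea m * Real.log (1 / ε)
      else sphereArea m / (-α) * (1 / ε ^ (-α)))

/-- The Hadamard finite part exists: on the interior of a bounded measurable set, the limit that
defines the potential for `α ≤ 0` exists. -/
theorem exists_tendsto_truncated {m : ℕ} (hm : 1 ≤ m) {Ω : Set (EuclideanSpace ℝ (Fin m))}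
    (hΩ : MeasurableSet Ω) (hb : Bornology.IsBounded Ω) {α : ℝ} (hα : α ≤ 0)
    {x : EuclideanSpace ℝ (Fin m)} (hx : x ∈ interior Ω) :
    ∃ l : ℝ, Tendsto (truncated Ω α x) (𝓝[>] (0 : ℝ)) (𝓝 l) := by
  have : Nonempty (Fin m) := ⟨⟨0, hm⟩⟩
  have hm' : (1 : ℝ) ≤ m := by exact_mod_cast hm
  obtain ⟨δ, hδ, hδΩ⟩ := Metric.nhds_basis_closedBall.mem_iff.1 (mem_interior_iff_mem_nhds.1 hx)
  have hint : ∀ ε : ℝ, 0 < ε →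
      IntegrableOn (fun y => ‖x - y‖ ^ (α - m)) (Ω \ closedBall x ε) := by
    intro ε hε
    have hfin : volume (Ω \ closedBall x ε) < ⊤ :=
      (measure_mono sdiff_subset).trans_lt hb.measure_lt_top
    refine Measure.integrableOn_of_bounded (M := ε ^ (α - m)) hfin.ne
      (Measurable.aestronglyMeasurable (by fun_prop)) ?_
    refine (ae_restrict_iff' (hΩ.diff measurableSet_closedBall)).2 (Eventually.of_forall ?_)
    intro y hy
    have hy2 : ε < ‖x - y‖ := by
      have := hy.2
      rw [mem_closedBall, not_le, dist_comm, dist_eq_norm] at this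
      exact this
    rw [Real.norm_of_nonneg (by positivity)]
    exact Real.rpow_le_rpow_of_nonpos hε hy2.le (by linarith)
  have hann : ∀ ε : ℝ, 0 < ε → ε ≤ δ →
      ∫ y in closedBall x δ \ closedBall x ε, ‖x - y‖ ^ (α - m) =
        sphereArea m * ∫ r in ε..δ, r ^ (α - 1) := by
    intro ε hε hεδ
    have h1 : ∫ y in closedBall x δ \ closedBall x ε, ‖x - y‖ ^ (α - m) =
        ∫ y : EuclideanSpace ℝ (Fin m), (Ioc ε δ).indicator (fun r : ℝ => r ^ (α - m)) ‖x - y‖ := by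
      rw [← integral_indicator (measurableSet_closedBall.diff measurableSet_closedBall)]
      congr 1
      ext y
      simp only [indicator, Set.mem_sdiff, mem_closedBall, mem_Ioc, not_le, dist_comm y x,
        dist_eq_norm, and_comm]
    rw [h1, integral_sub_left_eq_self
      (fun z => (Ioc ε δ).indicator (fun r : ℝ => r ^ (α - m)) ‖z‖) volume x,
      integral_fun_norm_addHaar, intervalIntegral.integral_of_le hεδ]
    have h2 : ∫ y in Ioi (0 : ℝ), y ^ (Module.finrank ℝ (EuclideanSpace ℝ (Fin m)) - 1) •
        (Ioc ε δ).indicator (fun r : ℝ => r ^ (α - m)) y = ∫ r in Ioc ε δ, r ^ (α - 1) := by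
      rw [← integral_indicator measurableSet_Ioi, ← integral_indicator measurableSet_Ioc]
      congr 1
      ext r
      by_cases hr : r ∈ Ioc ε δ
      · have hr0 : 0 < r := hε.trans hr.1
        rw [indicator_of_mem (show r ∈ Ioi (0 : ℝ) from hr0), indicator_of_mem hr,
          indicator_of_mem hr, finrank_euclideanSpace_fin, smul_eq_mul, ← Real.rpow_natCast,
          ← Real.rpow_add hr0, Nat.cast_sub hm]
        congr 1
        push_cast
        ring
      · simp [indicator, hr]
    rw [h2, sphereArea, unitSphereMeasure, Measure.toSphere_real_apply_univ]
    simp [mul_assoc]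
  have hsplit : ∀ ε : ℝ, 0 < ε → ε ≤ δ → ∫ y in Ω \ closedBall x ε, ‖x - y‖ ^ (α - m) =
      (∫ y in Ω \ closedBall x δ, ‖x - y‖ ^ (α - m)) +
        sphereArea m * ∫ r in ε..δ, r ^ (α - 1) := by
    intro ε hε hεδ
    have hU : Ω \ closedBall x ε =
        (Ω \ closedBall x δ) ∪ (closedBall x δ \ closedBall x ε) := by
      ext y
      have h1 : y ∈ closedBall x ε → y ∈ closedBall x δ := fun h => closedBall_subset_closedBall hεδ h
      have h2 : y ∈ closedBall x δ → y ∈ Ω := fun h => hδΩ h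
      simp only [Set.mem_sdiff, mem_union]
      tauto
    rw [← hann ε hε hεδ, hU]
    refine setIntegral_union ?_ (measurableSet_closedBall.diff measurableSet_closedBall)
      (hint δ hδ) ((hint ε hε).mono_set (sdiff_subset_sdiff_left hδΩ))
    exact disjoint_left.2 fun y h1 h2 => h1.2 h2.1
  have hzero : ∀ ε : ℝ, 0 < ε → ε ≤ δ → (0 : ℝ) ∉ uIcc ε δ := by
    intro ε hε hεδ h
    rw [uIcc_of_le hεδ] at h
    exact absurd h.1 (not_le.2 hε)
  refine ⟨truncated Ω α x δ, tendsto_const_nhds.congr' ?_⟩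
  filter_upwards [Ioc_mem_nhdsGT hδ] with ε hε
  rw [truncated, truncated, hsplit ε hε.1 hε.2]
  by_cases h0 : α = 0
  · have : ∫ r in ε..δ, r ^ (α - 1) = Real.log (δ / ε) := by
      rw [← integral_inv (hzero ε hε.1 hε.2)]
      simp [h0, Real.rpow_neg_one]
    rw [this, if_pos h0, if_pos h0, Real.log_div hδ.ne' hε.1.ne']
    simp only [one_div, Real.log_inv]
    ring
  · have : ∫ r in ε..δ, r ^ (α - 1) = (δ ^ α - ε ^ α) / α := by
      rw [integral_rpow (Or.inr ⟨by intro h; apply h0; linarith, hzero ε hε.1 hε.2⟩)]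
      simp
    rw [this, if_neg h0, if_neg h0, Real.rpow_neg hδ.le, Real.rpow_neg hε.1.le]
    simp only [one_div, inv_inv]
    field_simp
    ring

open Classical in
/-- The `r^{α-m}`-potential `V_Ω^{(α)}`. For `α ≤ 0` it is meaningful on the interior of `Ω` and on
the complement of `Ω`; on the boundary it is left unspecified in the literature, and the value
there (given by the last line) is never used below. -/
def potential {m : ℕ} (Ω : Set (EuclideanSpace ℝ (Fin m))) (α : ℝ)
    (x : EuclideanSpace ℝ (Fin m)) : ℝ :=
  if 0 < α then
    if α = m then -∫ y in Ω, Real.log ‖x - y‖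
    else Real.sign (m - α) * ∫ y in Ω, ‖x - y‖ ^ (α - m)
  else if x ∈ interior Ω then limUnder (𝓝[>] (0 : ℝ)) (truncated Ω α x)
  else ∫ y in Ω, ‖x - y‖ ^ (α - m)

/-- A circumcenter (`r^∞`-center) of `Ω`: a minimum point of `x ↦ max_{y ∈ Ω} |x - y|`. -/
def IsCircumcenter {m : ℕ} (Ω : Set (EuclideanSpace ℝ (Fin m)))
    (c : EuclideanSpace ℝ (Fin m)) : Prop :=
  IsMinOn (fun x => sSup ((fun y => ‖x - y‖) '' Ω)) univ c

/-- `IsCenter Ω α c`: the point `c` is an `r^{α-m}`-center of `Ω`, for `α ∈ (-∞, +∞]`. For `α > 0`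
it is a maximum point of the potential on `ℝ^m`, for `α ≤ 0` a maximum point of the restriction of
the potential to the interior of `Ω`, and for `α = +∞` a circumcenter. -/
def IsCenter {m : ℕ} (Ω : Set (EuclideanSpace ℝ (Fin m))) :
    WithTop ℝ → EuclideanSpace ℝ (Fin m) → Prop
  | ⊤, c => IsCircumcenter Ω c
  | (α : ℝ), c =>
    if 0 < α then IsMaxOn (potential Ω α) univ c
    else c ∈ interior Ω ∧ IsMaxOn (potential Ω α) (interior Ω) c

/-- The centroid (center of mass) of `Ω`. -/
def centroid {m : ℕ} (Ω : Set (EuclideanSpace ℝ (Fin m))) : EuclideanSpace ℝ (Fin m) :=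
  (volume.real Ω)⁻¹ • ∫ y in Ω, y

end RadialCenter

end

noncomputable section

open MeasureTheory Metric Set Filter Topology

namespace RadialCenter

/-! The balance law makes each spherical mean of the position vector about `x` vanish. By polar
coordinates, `∫ y in Ω, g ‖y - x‖ • (y - x) = 0` for every radial weight `g`
(`BalanceLaw.integral_radial_smul`). Everything follows from suitable choices of `g`.

The weight `1` gives the centroid. The indicator of a far region shows that any `c ≠ x` has a
farther point of `Ω` than `x` has (`exists_norm_lt`), hence the circumcenter.

For `p = α - m ≥ 1` the potential is `-∫ ‖c - y‖ ^ p`. The function `‖·‖ ^ p` lies above its tangent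
at `y - x`, and the linear term is a radial multiple of `y - x` paired with `c - x`, so it
integrates to zero. Hence `x` is a maximum, and the only one as soon as the tangent inequality is
strict on an open set meeting `Ω` (`potential_lt_of_tangent`).

For convex `Ω`, `α ≤ 1` and `α < m`, the potential at an interior point `c` is the integral over
directions `v` of `Φ(ρ(c, v))`, where `ρ` is the distance to the boundary and `Φ` a primitive of `t
^ (α - 1)` (`potential_eq_integral_sphere`). Convexity of `Ω` makes `ρ` concave in `c`, and `Φ` is
increasing and concave exactly because `α ≤ 1`; so the potential is concave, and strictly midpoint
concave (`potential_midpoint_lt`). Up to a constant it equals near `x` the integral of a Lipschitz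
truncated kernel, whose derivative at `x` vanishes by the balance law
(`BalanceLaw.hasDerivAt_setIntegral_max`). A critical point of a concave function is a maximum, and
strictness makes it unique.

For `0 < α` the boundary is reached by Fatou's lemma and the exterior by projection onto `Ω`. The
case `α = m = 1` is logarithmic: there `Ω` is an interval centered at `x`, and a rearrangement
argument applies (`setIntegral_log_lt`). -/

/-! ### Polar coordinates and the integrated balance law -/

/-- Integration in polar coordinates. -/
theorem integral_eq_integral_sphere_prod {m : ℕ} (hm : 1 ≤ m) {F : Type*} [NormedAddCommGroup F]
    [NormedSpace ℝ F] (f : EuclideanSpace ℝ (Fin m) → F) :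
    ∫ z, f z = ∫ p : sphere (0 : EuclideanSpace ℝ (Fin m)) 1 × Ioi (0 : ℝ),
      f ((p.2 : ℝ) • (p.1 : EuclideanSpace ℝ (Fin m)))
        ∂((unitSphereMeasure m).prod (Measure.volumeIoiPow (m - 1))) := by
  have : Nonempty (Fin m) := ⟨⟨0, hm⟩⟩
  have h := (volume : Measure (EuclideanSpace ℝ (Fin m))).measurePreserving_homeomorphUnitSphereProd
  have h2 := h.integral_comp (Homeomorph.measurableEmbedding _)
    (fun p => f ((p.2 : ℝ) • (p.1 : EuclideanSpace ℝ (Fin m))))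
  rw [finrank_euclideanSpace_fin] at h2
  have h3 : ∫ z, f z = ∫ z in {(0 : EuclideanSpace ℝ (Fin m))}ᶜ, f z := by
    rw [restrict_compl_singleton]
  rw [h3, unitSphereMeasure, ← h2, ← integral_subtype_comap (measurableSet_singleton _).compl f]
  congr 1 with z
  have hz : ‖(z : EuclideanSpace ℝ (Fin m))‖ ≠ 0 := norm_ne_zero_iff.2 z.2
  simp [smul_smul, hz]

theorem integrable_iff_integrable_sphere_prod {m : ℕ} (hm : 1 ≤ m) {F : Type*}
    [NormedAddCommGroup F] (f : EuclideanSpace ℝ (Fin m) → F) :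
    Integrable f ↔ Integrable (fun p : sphere (0 : EuclideanSpace ℝ (Fin m)) 1 × Ioi (0 : ℝ) =>
      f ((p.2 : ℝ) • (p.1 : EuclideanSpace ℝ (Fin m))))
        ((unitSphereMeasure m).prod (Measure.volumeIoiPow (m - 1))) := by
  have : Nonempty (Fin m) := ⟨⟨0, hm⟩⟩
  have h := (volume : Measure (EuclideanSpace ℝ (Fin m))).measurePreserving_homeomorphUnitSphereProd
  have h2 := h.integrable_comp_emb (Homeomorph.measurableEmbedding _)
    (g := fun p => f ((p.2 : ℝ) • (p.1 : EuclideanSpace ℝ (Fin m))))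
  rw [finrank_euclideanSpace_fin] at h2
  have h3 : Integrable f ↔ IntegrableOn f {(0 : EuclideanSpace ℝ (Fin m))}ᶜ := by
    rw [IntegrableOn, restrict_compl_singleton]
  rw [h3, unitSphereMeasure, ← h2, integrableOn_iff_comap_subtypeVal (measurableSet_singleton _).compl]
  congr! 1
  ext z
  have hz : ‖(z : EuclideanSpace ℝ (Fin m))‖ ≠ 0 := norm_ne_zero_iff.2 z.2
  simp [smul_smul, hz]

instance (m : ℕ) : IsFiniteMeasure (unitSphereMeasure m) := by
  unfold unitSphereMeasure; infer_instance

instance (m : ℕ) : (unitSphereMeasure m).IsOpenPosMeasure := by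
  unfold unitSphereMeasure; infer_instance

/-- Under the balance law, the spherical averages of the indicator times the position vanish. -/
theorem BalanceLaw.integral_sphere_eq_zero {m : ℕ}
    {Ω : Set (EuclideanSpace ℝ (Fin m))} (hΩ : MeasurableSet Ω) {x : EuclideanSpace ℝ (Fin m)}
    (hx : BalanceLaw Ω x) {r : ℝ} (hr : 0 < r) :
    ∫ v, indicator {z | x + z ∈ Ω} id (r • (v : EuclideanSpace ℝ (Fin m)))
      ∂(unitSphereMeasure m) = 0 := by
  have hS : MeasurableSet {z : EuclideanSpace ℝ (Fin m) | x + z ∈ Ω} :=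
    hΩ.preimage (measurable_const_add x)
  have h := hx r hr.le
  change ∫ v in {z | x + z ∈ Ω}, id v ∂(sphereMeasure m r) = 0 at h
  rw [sphereMeasure, ← integral_indicator hS, integral_smul_measure,
    integral_map (by fun_prop) (Measurable.aestronglyMeasurable (measurable_id.indicator hS)),
    smul_eq_zero] at h
  refine h.resolve_left ?_
  rw [ENNReal.toReal_ofReal (by positivity)]
  positivity

/-- The balance law kills every integral of a radial multiple of the position vector. -/
theorem BalanceLaw.integral_radial_smul {m : ℕ} (hm : 1 ≤ m)
    {Ω : Set (EuclideanSpace ℝ (Fin m))} (hΩ : MeasurableSet Ω) {x : EuclideanSpace ℝ (Fin m)}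
    (hx : BalanceLaw Ω x) (g : ℝ → ℝ) :
    ∫ y in Ω, g ‖y - x‖ • (y - x) = 0 := by
  have hS : MeasurableSet {z : EuclideanSpace ℝ (Fin m) | x + z ∈ Ω} :=
    hΩ.preimage (measurable_const_add x)
  rw [← integral_indicator hΩ, ← integral_add_left_eq_self _ x,
    integral_eq_integral_sphere_prod hm]
  by_cases hint : Integrable (fun p : sphere (0 : EuclideanSpace ℝ (Fin m)) 1 × Ioi (0 : ℝ) =>
      Ω.indicator (fun y => g ‖y - x‖ • (y - x))
        (x + (p.2 : ℝ) • (p.1 : EuclideanSpace ℝ (Fin m))))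
      ((unitSphereMeasure m).prod (Measure.volumeIoiPow (m - 1)))
  -- Fubini with the radius outermost: at fixed radius `g` is a constant factor and the balance law
  -- kills the sphere integral.
  · rw [integral_prod_symm _ hint]
    refine integral_eq_zero_of_ae (Eventually.of_forall fun r => ?_)
    have hr : (0 : ℝ) < r := r.2
    have : ∀ v : sphere (0 : EuclideanSpace ℝ (Fin m)) 1, Ω.indicator (fun y => g ‖y - x‖ • (y - x))
        (x + (r : ℝ) • (v : EuclideanSpace ℝ (Fin m))) =
        g r • indicator {z | x + z ∈ Ω} id ((r : ℝ) • (v : EuclideanSpace ℝ (Fin m))) := by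
      intro v
      by_cases h : x + (r : ℝ) • (v : EuclideanSpace ℝ (Fin m)) ∈ Ω
      · rw [indicator_of_mem h, indicator_of_mem (by exact h)]
        simp [norm_smul, abs_of_pos hr]
      · rw [indicator_of_notMem h, indicator_of_notMem (by exact h), smul_zero]
    simp only [this]
    rw [integral_smul, hx.integral_sphere_eq_zero hΩ hr, smul_zero]
    rfl
  -- The integral of a non-integrable function is `0` by convention, so no hypothesis on `g` is
  -- needed.
  · exact integral_undef hint

/-- Scalar form of `BalanceLaw.integral_radial_smul`. -/
theorem BalanceLaw.integral_radial_inner {m : ℕ} (hm : 1 ≤ m)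
    {Ω : Set (EuclideanSpace ℝ (Fin m))} (hΩ : MeasurableSet Ω) {x : EuclideanSpace ℝ (Fin m)}
    (hx : BalanceLaw Ω x) (g : ℝ → ℝ) (c : EuclideanSpace ℝ (Fin m))
    (hg : IntegrableOn (fun y => g ‖y - x‖ • (y - x)) Ω) :
    ∫ y in Ω, g ‖y - x‖ * inner ℝ (y - x) c = 0 := by
  have h := integral_inner (𝕜 := ℝ) hg c
  rw [hx.integral_radial_smul hm hΩ, inner_zero_right] at h
  rw [← h]
  congr 1 with y
  rw [inner_smul_right, real_inner_comm]

/-! ### Bodies -/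

theorem IsBody.isCompact {m : ℕ} {Ω : Set (EuclideanSpace ℝ (Fin m))} (hΩ : IsBody Ω) :
    IsCompact Ω := by
  obtain ⟨U, -, hb, -, rfl⟩ := hΩ
  exact hb.isCompact_closure

theorem IsBody.measurableSet {m : ℕ} {Ω : Set (EuclideanSpace ℝ (Fin m))} (hΩ : IsBody Ω) :
    MeasurableSet Ω :=
  hΩ.isCompact.isClosed.measurableSet

theorem IsBody.subset_closure_interior {m : ℕ} {Ω : Set (EuclideanSpace ℝ (Fin m))}
    (hΩ : IsBody Ω) : Ω ⊆ closure (interior Ω) := by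
  obtain ⟨U, ho, -, -, rfl⟩ := hΩ
  exact closure_mono (interior_maximal subset_closure ho)

theorem IsBody.interior_nonempty {m : ℕ} {Ω : Set (EuclideanSpace ℝ (Fin m))}
    (hΩ : IsBody Ω) : (interior Ω).Nonempty := by
  obtain ⟨U, ho, -, hne, rfl⟩ := hΩ
  exact hne.mono (interior_maximal subset_closure ho)

/-- An open set that meets a body meets it in positive measure. -/
theorem IsBody.measure_inter_pos {m : ℕ} {Ω : Set (EuclideanSpace ℝ (Fin m))}
    (hΩ : IsBody Ω) {V : Set (EuclideanSpace ℝ (Fin m))} (hV : IsOpen V) (h : (V ∩ Ω).Nonempty) :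
    0 < volume (V ∩ Ω) := by
  obtain ⟨y, hyV, hyΩ⟩ := h
  obtain ⟨z, hz⟩ := mem_closure_iff.1 (hΩ.subset_closure_interior hyΩ) V hV hyV
  exact ((hV.inter isOpen_interior).measure_pos _ ⟨z, hz⟩).trans_le
    (measure_mono (inter_subset_inter_right _ interior_subset))

theorem IsBody.volume_pos {m : ℕ} {Ω : Set (EuclideanSpace ℝ (Fin m))} (hΩ : IsBody Ω) :
    0 < volume Ω := by
  simpa using hΩ.measure_inter_pos isOpen_univ
    (by simpa using hΩ.interior_nonempty.mono interior_subset)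

/-- A continuous function is integrable on a body. -/
theorem IsBody.integrableOn {m : ℕ} {Ω : Set (EuclideanSpace ℝ (Fin m))} (hΩ : IsBody Ω)
    {F : Type*} [NormedAddCommGroup F] {f : EuclideanSpace ℝ (Fin m) → F} (hf : Continuous f) :
    IntegrableOn f Ω :=
  hf.continuousOn.integrableOn_compact hΩ.isCompact

/-- Strict monotonicity of the integral. -/
theorem setIntegral_lt_setIntegral {X : Type*} [MeasurableSpace X] {μ : Measure X} {s : Set X}
    (hs : MeasurableSet s) {f g : X → ℝ} (hf : IntegrableOn f s μ) (hg : IntegrableOn g s μ)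
    (hle : ∀ y ∈ s, f y ≤ g y) {t : Set X} (ht : 0 < μ (t ∩ s)) (hlt : ∀ y ∈ t ∩ s, f y < g y) :
    ∫ y in s, f y ∂μ < ∫ y in s, g y ∂μ := by
  rw [← sub_pos, ← integral_sub hg hf, setIntegral_pos_iff_support_of_nonneg_ae
    ((ae_restrict_iff' hs).2 (Eventually.of_forall fun y hy => sub_nonneg.2 (hle y hy)))
    (hg.sub hf)]
  refine ht.trans_le (measure_mono fun y hy => ⟨?_, hy.2⟩)
  exact (sub_pos.2 (hlt y hy)).ne'

/-! ### Centroid and circumcenter -/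

theorem centroid_eq {m : ℕ} (hm : 1 ≤ m) {Ω : Set (EuclideanSpace ℝ (Fin m))}
    (hΩ : IsBody Ω) {x : EuclideanSpace ℝ (Fin m)} (hx : BalanceLaw Ω x) : centroid Ω = x := by
  have h := hx.integral_radial_smul hm hΩ.measurableSet (fun _ => 1)
  have hv : volume.real Ω ≠ 0 :=
    (ENNReal.toReal_pos hΩ.volume_pos.ne' hΩ.isCompact.measure_lt_top.ne).ne'
  simp only [one_smul] at h
  rw [integral_sub (hΩ.integrableOn (f := fun y => y) continuous_id) (hΩ.integrableOn continuous_const),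
    setIntegral_const, sub_eq_zero] at h
  rw [centroid, h, smul_smul, inv_mul_cancel₀ hv, one_smul]

/-- Moving away from the balance point strictly increases the circumradius. -/
theorem exists_norm_lt {m : ℕ} (hm : 1 ≤ m) {Ω : Set (EuclideanSpace ℝ (Fin m))}
    (hΩ : IsBody Ω) {x : EuclideanSpace ℝ (Fin m)} (hx : BalanceLaw Ω x)
    {c : EuclideanSpace ℝ (Fin m)} (hc : c ≠ x) {w : EuclideanSpace ℝ (Fin m)} (hw : w ∈ Ω) :
    ∃ y ∈ Ω, ‖x - w‖ < ‖c - y‖ := by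
  by_contra! hcon
  have hd : 0 < ‖c - x‖ ^ 2 := by have := norm_pos_iff.2 (sub_ne_zero.2 hc); positivity
  -- The threshold is the one beyond which `‖c - y‖ ≤ ‖x - w‖` forces `inner ℝ (y - x) (c - x) > 0`.
  -- Since `c ≠ x`, the point `w` itself lies in `V`. As `V` is radial about `x`, its indicator is
  -- an admissible weight.
  set V : Set (EuclideanSpace ℝ (Fin m)) := {y | ‖x - w‖ ^ 2 - ‖c - x‖ ^ 2 < ‖y - x‖ ^ 2} with hV
  have hVo : IsOpen V := isOpen_lt (by fun_prop) (by fun_prop)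
  set g : ℝ → ℝ := {s | ‖x - w‖ ^ 2 - ‖c - x‖ ^ 2 < s ^ 2}.indicator (fun _ => 1) with hg
  have hgm : Measurable g :=
    measurable_const.indicator (measurableSet_lt (by fun_prop) (by fun_prop))
  have hgb : ∀ s, ‖g s‖ ≤ 1 := fun s => by
    rw [hg]; exact (norm_indicator_le_norm_self _ _).trans (by simp)
  have hint : IntegrableOn (fun y => g ‖y - x‖ • (y - x)) Ω := by
    exact Integrable.bdd_smul (C := 1) (hΩ.integrableOn (f := fun y => y - x) (by fun_prop))
      (hgm.comp (by fun_prop : Measurable fun y => ‖y - x‖)).aestronglyMeasurable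
      (Eventually.of_forall fun y => hgb _)
  have h0 := hx.integral_radial_inner hm hΩ.measurableSet g (c - x) hint
  have hint2 : IntegrableOn (fun y => g ‖y - x‖ * inner ℝ (y - x) (c - x)) Ω := by
    refine (hint.inner_const (𝕜 := ℝ) (c - x)).congr (Eventually.of_forall fun y => ?_)
    simp [inner_smul_left]
  have hkey : ∀ y ∈ V ∩ Ω, 0 < g ‖y - x‖ * inner ℝ (y - x) (c - x) := by
    intro y hy
    have hy1 : g ‖y - x‖ = 1 := indicator_of_mem (by exact hy.1) _
    rw [hy1, one_mul]
    have h1 := hcon y hy.2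
    have h2 : ‖c - y‖ ^ 2 = ‖y - x‖ ^ 2 - 2 * inner ℝ (y - x) (c - x) + ‖c - x‖ ^ 2 := by
      rw [← norm_sub_sq_real, sub_sub_sub_cancel_right, norm_sub_rev]
    have h3 : ‖c - y‖ ^ 2 ≤ ‖x - w‖ ^ 2 := by gcongr
    have h4 : ‖x - w‖ ^ 2 - ‖c - x‖ ^ 2 < ‖y - x‖ ^ 2 := hy.1
    linarith
  have hlt := setIntegral_lt_setIntegral hΩ.measurableSet
    (integrableOn_zero : IntegrableOn (fun _ => (0 : ℝ)) Ω) hint2 (t := V) (fun y hy => by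
      by_cases hyV : y ∈ V
      · exact (hkey y ⟨hyV, hy⟩).le
      · have : g ‖y - x‖ = 0 := indicator_of_notMem (by exact hyV) _
        simp [this])
    (hΩ.measure_inter_pos hVo ⟨w, by simp only [hV, mem_ofPred_eq, norm_sub_rev w x]; linarith, hw⟩)
    hkey
  simp [h0] at hlt

theorem isCircumcenter_iff {m : ℕ} (hm : 1 ≤ m) {Ω : Set (EuclideanSpace ℝ (Fin m))}
    (hΩ : IsBody Ω) {x : EuclideanSpace ℝ (Fin m)} (hx : BalanceLaw Ω x)
    (c : EuclideanSpace ℝ (Fin m)) : IsCircumcenter Ω c ↔ c = x := by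
  have hne : Ω.Nonempty := hΩ.interior_nonempty.mono interior_subset
  have hlt : ∀ c, c ≠ x → sSup ((fun y => ‖x - y‖) '' Ω) < sSup ((fun y => ‖c - y‖) '' Ω) := by
    intro c hc
    obtain ⟨w, hw, hwe⟩ := hΩ.isCompact.exists_sSup_image_eq hne
      (f := fun y => ‖x - y‖) (by fun_prop)
    obtain ⟨y, hy, hyw⟩ := exists_norm_lt hm hΩ hx hc hw
    rw [hwe]
    refine hyw.trans_le (le_csSup ?_ (mem_image_of_mem _ hy))
    exact (hΩ.isCompact.image (by fun_prop)).bddAbove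
  constructor
  · intro h
    by_contra hc
    exact (hlt c hc).not_ge (h (mem_univ x))
  · rintro rfl y -
    change sSup ((fun w => ‖c - w‖) '' Ω) ≤ sSup ((fun w => ‖y - w‖) '' Ω)
    by_cases hy : y = c
    · rw [hy]
    · exact (hlt y hy).le

/-! ### Powers of the distance with exponent at least one -/

section Tangent

variable {E : Type*} [NormedAddCommGroup E] [InnerProductSpace ℝ E]

/-- Cauchy–Schwarz for `a` and `a - d`, divided by `‖a‖`; for `a = 0` the convention for division by
zero leaves a trivial inequality. -/
theorem inner_sub_div_le (a d : E) : ‖a‖ - inner ℝ a d / ‖a‖ ≤ ‖a - d‖ := by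
  by_cases ha : a = 0
  · simp [ha]
  have ha' : 0 < ‖a‖ := norm_pos_iff.2 ha
  have h := real_inner_le_norm a (a - d)
  rw [inner_sub_right, real_inner_self_eq_norm_sq] at h
  rw [sub_le_iff_le_add, ← sub_le_iff_le_add', le_div_iff₀ ha']
  nlinarith

theorem rpow_sub_two_mul {r : ℝ} (hr : 0 < r) (p s : ℝ) :
    r ^ (p - 2) * s = r ^ p * (s / r / r) := by
  rw [Real.rpow_sub hr, Real.rpow_two]
  field_simp

/-- The tangent inequality of the convex function `‖·‖ ^ p`. -/
theorem rpow_norm_tangent_le {p : ℝ} (hp : 1 ≤ p) (a d : E) :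
    ‖a‖ ^ p - p * (‖a‖ ^ (p - 2) * inner ℝ a d) ≤ ‖a - d‖ ^ p := by
  by_cases ha : a = 0
  · have : p ≠ 0 := by linarith
    simp only [ha, norm_zero, Real.zero_rpow this, inner_zero_left, mul_zero, sub_zero]
    positivity
  have ha' : 0 < ‖a‖ := norm_pos_iff.2 ha
  have h1 := inner_sub_div_le a d
  -- Bernoulli's inequality reduces the claim for `p` to the tangent inequality `h1` for the norm
  -- itself.
  have h2 := one_add_mul_self_le_rpow_one_add (s := ‖a - d‖ / ‖a‖ - 1)
    (by have : 0 ≤ ‖a - d‖ / ‖a‖ := by positivity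
        linarith) hp
  rw [add_sub_cancel, Real.div_rpow (norm_nonneg _) (norm_nonneg _),
    le_div_iff₀ (by positivity)] at h2
  refine le_trans ?_ h2
  rw [rpow_sub_two_mul ha']
  have h3 : 1 - inner ℝ a d / ‖a‖ / ‖a‖ ≤ ‖a - d‖ / ‖a‖ := by
    rw [le_div_iff₀ ha']; field_simp at h1 ⊢; exact h1
  have h4 : 0 < ‖a‖ ^ p := by positivity
  have h5 : p * (1 - inner ℝ a d / ‖a‖ / ‖a‖) ≤ p * (‖a - d‖ / ‖a‖) := by gcongr
  nlinarith

/-- For exponents greater than one the tangent inequality is strict. -/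
theorem rpow_norm_tangent_lt {p : ℝ} (hp : 1 < p) (a : E) {d : E} (hd : d ≠ 0) :
    ‖a‖ ^ p - p * (‖a‖ ^ (p - 2) * inner ℝ a d) < ‖a - d‖ ^ p := by
  by_cases ha : a = 0
  · have : p ≠ 0 := by linarith
    have hd' : 0 < ‖d‖ := norm_pos_iff.2 hd
    simp only [ha, norm_zero, Real.zero_rpow this, inner_zero_left, mul_zero, sub_zero, zero_sub,
      norm_neg]
    positivity
  have ha' : 0 < ‖a‖ := norm_pos_iff.2 ha
  -- Bernoulli is strict unless the two norms agree; in that case `d ≠ 0` makes `inner ℝ a d`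
  -- positive, so the tangent lies strictly below.
  by_cases hs : ‖a - d‖ = ‖a‖
  · have h1 := norm_sub_sq_real a d
    have hd' : 0 < ‖d‖ ^ 2 := by have := norm_pos_iff.2 hd; positivity
    have h2 : 0 < inner ℝ a d := by rw [hs] at h1; linarith
    rw [hs]
    have : 0 < p * (‖a‖ ^ (p - 2) * inner ℝ a d) := by positivity
    linarith
  have h1 := inner_sub_div_le a d
  have h2 := one_add_mul_self_lt_rpow_one_add (s := ‖a - d‖ / ‖a‖ - 1)
    (by have : 0 ≤ ‖a - d‖ / ‖a‖ := by positivity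
        linarith) (by rwa [sub_ne_zero, Ne, div_eq_one_iff_eq ha'.ne']) hp
  rw [add_sub_cancel, Real.div_rpow (norm_nonneg _) (norm_nonneg _),
    lt_div_iff₀ (by positivity)] at h2
  refine lt_of_le_of_lt ?_ h2
  rw [rpow_sub_two_mul ha']
  have h3 : 1 - inner ℝ a d / ‖a‖ / ‖a‖ ≤ ‖a - d‖ / ‖a‖ := by
    rw [le_div_iff₀ ha']; field_simp at h1 ⊢; exact h1
  have h4 : 0 < ‖a‖ ^ p := by positivity
  have h5 : p * (1 - inner ℝ a d / ‖a‖ / ‖a‖) ≤ p * (‖a - d‖ / ‖a‖) := by gcongr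
  nlinarith

/-- The tangent inequality of the norm is strict unless the two vectors are on the same ray. -/
theorem norm_tangent_lt {a d : E} (h : inner ℝ a (a - d) < ‖a‖ * ‖a - d‖) :
    ‖a‖ ^ (1 : ℝ) - 1 * (‖a‖ ^ ((1 : ℝ) - 2) * inner ℝ a d) < ‖a - d‖ ^ (1 : ℝ) := by
  have ha' : 0 < ‖a‖ := by
    rcases (norm_nonneg a).eq_or_lt with h0 | h0
    · rw [← h0, norm_eq_zero.1 h0.symm] at h; simp at h
    · exact h0
  rw [inner_sub_right, real_inner_self_eq_norm_sq] at h
  rw [rpow_sub_two_mul ha', Real.rpow_one, Real.rpow_one, one_mul, mul_div_cancel₀ _ ha'.ne',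
    sub_lt_iff_lt_add, ← sub_lt_iff_lt_add', lt_div_iff₀ ha']
  nlinarith

end Tangent

/-! ### The balance point as strict maximum for `α ≥ m + 1` -/

theorem potential_of_dim_lt {m : ℕ} (hm : 1 ≤ m) (Ω : Set (EuclideanSpace ℝ (Fin m))) {α : ℝ}
    (hα : m < α) (c : EuclideanSpace ℝ (Fin m)) :
    potential Ω α c = -∫ y in Ω, ‖c - y‖ ^ (α - m) := by
  have hm' : (0 : ℝ) < m := by exact_mod_cast hm
  rw [potential, if_pos (hm'.trans hα), if_neg hα.ne', Real.sign_of_neg (by linarith)]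
  ring

/-- Comparison of potentials for exponents at least one, given strictness on an open set. -/
theorem potential_lt_of_tangent {m : ℕ} (hm : 1 ≤ m) {Ω : Set (EuclideanSpace ℝ (Fin m))}
    (hΩ : IsBody Ω) {x : EuclideanSpace ℝ (Fin m)} (hx : BalanceLaw Ω x) {α : ℝ}
    (hα : m + 1 ≤ α) {c : EuclideanSpace ℝ (Fin m)} {V : Set (EuclideanSpace ℝ (Fin m))}
    (hV : IsOpen V) (hVΩ : (V ∩ Ω).Nonempty)
    (hlt : ∀ y ∈ V, ‖y - x‖ ^ (α - m) - (α - m) * (‖y - x‖ ^ (α - m - 2) *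
      inner ℝ (y - x) (c - x)) < ‖y - x - (c - x)‖ ^ (α - m)) :
    potential Ω α c < potential Ω α x := by
  have hp : 1 ≤ α - m := by linarith
  have hp0 : 0 ≤ α - m := by linarith
  rw [potential_of_dim_lt hm Ω (by linarith), potential_of_dim_lt hm Ω (by linarith), neg_lt_neg_iff]
  set p := α - m with hpdef
  have hcont : ∀ z : EuclideanSpace ℝ (Fin m), Continuous fun y => ‖y - z‖ ^ p := fun z =>
    (continuous_id.sub continuous_const).norm.rpow_const fun _ => Or.inr hp0
  -- For `p < 2` the weight is singular at `x`, but the factor `y - x` leaves the norm bounded by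
  -- the continuous function `‖y - x‖ ^ (p - 1)`.
  have hint : IntegrableOn (fun y => ‖y - x‖ ^ (p - 2) • (y - x)) Ω := by
    have h1 : Continuous fun y : EuclideanSpace ℝ (Fin m) => ‖y - x‖ ^ (p - 1) :=
      (continuous_id.sub continuous_const).norm.rpow_const fun _ => Or.inr (by linarith)
    refine (hΩ.integrableOn h1).mono' (Measurable.aestronglyMeasurable (by fun_prop))
      (Eventually.of_forall fun y => ?_)
    rw [norm_smul, Real.norm_of_nonneg (by positivity)]
    by_cases hy : y = x
    · simp only [hy, sub_self, norm_zero, mul_zero]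
      positivity
    · have hy' : 0 < ‖y - x‖ := norm_pos_iff.2 (sub_ne_zero.2 hy)
      rw [← Real.rpow_add_one hy'.ne']
      exact le_of_eq (by congr 1; ring)
  have h0 := hx.integral_radial_inner hm hΩ.measurableSet (fun s => s ^ (p - 2)) (c - x) hint
  have hint2 : IntegrableOn (fun y => p * (‖y - x‖ ^ (p - 2) * inner ℝ (y - x) (c - x))) Ω := by
    refine Integrable.const_mul ((hint.inner_const (𝕜 := ℝ) (c - x)).congr
      (Eventually.of_forall fun y => ?_)) p
    simp [inner_smul_left]
  have hI : ∫ y in Ω, ‖x - y‖ ^ p = ∫ y in Ω, (‖y - x‖ ^ p -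
      p * (‖y - x‖ ^ (p - 2) * inner ℝ (y - x) (c - x))) := by
    rw [integral_sub (hΩ.integrableOn (hcont x)) hint2, integral_const_mul, h0, mul_zero, sub_zero]
    simp only [norm_sub_rev]
  rw [hI]
  have hrev : ∀ y : EuclideanSpace ℝ (Fin m), ‖c - y‖ = ‖y - x - (c - x)‖ := fun y => by
    rw [sub_sub_sub_cancel_right, norm_sub_rev]
  simp only [hrev]
  refine setIntegral_lt_setIntegral hΩ.measurableSet ((hΩ.integrableOn (hcont x)).sub hint2)
    ?_ (fun y _ => rpow_norm_tangent_le hp _ _) (hΩ.measure_inter_pos hV hVΩ)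
    fun y hy => hlt y hy.1
  simp only [sub_sub_sub_cancel_right]
  exact hΩ.integrableOn (hcont c)

theorem potential_lt_of_dim_add_one_lt {m : ℕ} (hm : 1 ≤ m) {Ω : Set (EuclideanSpace ℝ (Fin m))}
    (hΩ : IsBody Ω) {x : EuclideanSpace ℝ (Fin m)} (hx : BalanceLaw Ω x) {α : ℝ}
    (hα : m + 1 < α) {c : EuclideanSpace ℝ (Fin m)} (hc : c ≠ x) :
    potential Ω α c < potential Ω α x :=
  potential_lt_of_tangent hm hΩ hx hα.le isOpen_univ
    (by simpa using hΩ.interior_nonempty.mono interior_subset)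
    fun y _ => rpow_norm_tangent_lt (by linarith) _ (sub_ne_zero.2 hc)

/-- In dimension at least two, a nonempty open set is not contained in a line. -/
theorem exists_mem_forall_ne_line {m : ℕ} (hm : 2 ≤ m) {U : Set (EuclideanSpace ℝ (Fin m))}
    (hU : IsOpen U) (hne : U.Nonempty) (x d : EuclideanSpace ℝ (Fin m)) :
    ∃ y ∈ U, y - x ∉ Submodule.span ℝ {d} := by
  by_contra! h
  have hspan : Submodule.span ℝ {d} ≠ ⊤ := by
    intro htop
    have h1 := finrank_span_le_card (R := ℝ) ({d} : Set (EuclideanSpace ℝ (Fin m)))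
    rw [htop, finrank_top, finrank_euclideanSpace_fin, toFinset_singleton,
      Finset.card_singleton] at h1
    omega
  have h2 : volume ((Submodule.span ℝ {d} : Submodule ℝ (EuclideanSpace ℝ (Fin m))) :
    Set (EuclideanSpace ℝ (Fin m))) = 0 := Measure.addHaar_submodule _ _ hspan
  have h3 : volume ((fun y => y - x) ⁻¹' ((Submodule.span ℝ {d} :
      Submodule ℝ (EuclideanSpace ℝ (Fin m))) : Set (EuclideanSpace ℝ (Fin m)))) = 0 := by
    simp only [sub_eq_add_neg, measure_preimage_add_right, h2]
  exact (hU.measure_pos volume hne).ne' (measure_mono_null (fun y hy => h y hy) h3)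

/-- Only `α = m + 1` is new. The tangent inequality of the norm itself is strict unless `y - x` and
`y - c` lie on one ray, and a body of dimension at least two has interior points off the line
through `x` and `c`. -/
theorem potential_lt_of_dim_add_one_le {m : ℕ} (hm : 2 ≤ m) {Ω : Set (EuclideanSpace ℝ (Fin m))}
    (hΩ : IsBody Ω) {x : EuclideanSpace ℝ (Fin m)} (hx : BalanceLaw Ω x) {α : ℝ}
    (hα : m + 1 ≤ α) {c : EuclideanSpace ℝ (Fin m)} (hc : c ≠ x) :
    potential Ω α c < potential Ω α x := by
  rcases hα.lt_or_eq with hα' | hα'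
  · exact potential_lt_of_dim_add_one_lt (by omega) hΩ hx hα' hc
  have hα1 : α - m = 1 := by linarith
  refine potential_lt_of_tangent (by omega) hΩ hx hα
    (V := {y | inner ℝ (y - x) (y - x - (c - x)) < ‖y - x‖ * ‖y - x - (c - x)‖})
    (isOpen_lt (by fun_prop) (by fun_prop)) ?_ fun y hy => by
      rw [hα1]
      exact norm_tangent_lt hy
  obtain ⟨y, hy, hyl⟩ := exists_mem_forall_ne_line hm isOpen_interior hΩ.interior_nonempty x (c - x)
  refine ⟨y, ?_, interior_subset hy⟩
  refine (real_inner_le_norm _ _).lt_of_ne fun heq => hyl ?_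
  rw [Submodule.mem_span_singleton]
  have hne : y - x ≠ 0 := fun h0 => hyl (h0 ▸ zero_mem _)
  have h2 := inner_eq_norm_mul_iff_real.1 heq
  have hk : ‖y - x‖ - ‖y - x - (c - x)‖ ≠ 0 := by
    intro hk
    have h3 : ‖y - x - (c - x)‖ = ‖y - x‖ := by linarith
    rw [h3] at h2
    have h4 := smul_right_injective _ (norm_ne_zero_iff.2 hne) h2
    exact hc (by simpa [sub_eq_zero] using h4.symm)
  -- Solves the equality case `h2`, that is `‖a - d‖ • a = ‖a‖ • (a - d)` with `a = y - x` and `d =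
  -- c - x`, for `a` as a multiple of `d`.
  refine ⟨‖y - x‖ / (‖y - x‖ - ‖y - x - (c - x)‖), ?_⟩
  rw [div_eq_inv_mul, mul_smul, inv_smul_eq_iff₀ hk, sub_smul, h2, ← smul_sub, sub_sub_cancel]

/-- If the balance point is interior, exponent one is covered in every dimension. -/
theorem potential_lt_of_mem_interior {m : ℕ} (hm : 1 ≤ m) {Ω : Set (EuclideanSpace ℝ (Fin m))}
    (hΩ : IsBody Ω) {x : EuclideanSpace ℝ (Fin m)} (hx : BalanceLaw Ω x) (hxi : x ∈ interior Ω)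
    {α : ℝ} (hα : m + 1 ≤ α) {c : EuclideanSpace ℝ (Fin m)} (hc : c ≠ x) :
    potential Ω α c < potential Ω α x := by
  rcases hα.lt_or_eq with hα' | hα'
  · exact potential_lt_of_dim_add_one_lt hm hΩ hx hα' hc
  have hα1 : α - m = 1 := by linarith
  -- This `V` is the open ball with diameter from `x` to `c`; it meets every neighbourhood of `x`,
  -- hence meets `Ω` because `x` is interior.
  refine potential_lt_of_tangent hm hΩ hx hα
    (V := {y | inner ℝ (y - x) (y - x - (c - x)) < 0})
    (isOpen_lt (by fun_prop) (by fun_prop)) ?_ fun y hy => by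
      rw [hα1]
      exact norm_tangent_lt (lt_of_lt_of_le hy (by positivity))
  have ht : Tendsto (fun t : ℝ => x + t • (c - x)) (𝓝[>] 0) (𝓝 x) := by
    have : Continuous fun t : ℝ => x + t • (c - x) := by fun_prop
    simpa using (this.tendsto 0).mono_left nhdsWithin_le_nhds
  obtain ⟨t, ht1, ht2⟩ := ((ht.eventually (isOpen_interior.mem_nhds hxi)).and
    (Ioo_mem_nhdsGT one_pos)).exists
  refine ⟨x + t • (c - x), ?_, interior_subset ht1⟩
  have hd : 0 < ‖c - x‖ := norm_pos_iff.2 (sub_ne_zero.2 hc)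
  have h1 : x + t • (c - x) - x = t • (c - x) := by abel
  have h2 : t • (c - x) - (c - x) = (t - 1) • (c - x) := by rw [sub_smul, one_smul]
  simp only [mem_ofPred_eq, h1, h2, inner_smul_left, inner_smul_right, real_inner_self_eq_norm_sq]
  have : 0 < t * ((1 - t) * ‖c - x‖ ^ 2) := by
    have := ht2.1
    have := sub_pos.2 ht2.2
    positivity
  simp only [conj_trivial]
  linarith

/-! ### The radial function of a convex body -/

theorem preimage_add_mem_nhds_zero {E : Type*} [NormedAddCommGroup E] {Ω : Set E} {c : E}
    (hc : c ∈ interior Ω) :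
    (fun z => c + z) ⁻¹' Ω ∈ 𝓝 (0 : E) := by
  have h : Continuous fun z => c + z := by fun_prop
  exact h.continuousAt (by simpa using mem_interior_iff_mem_nhds.1 hc)

section Radial

variable {E : Type*} [NormedAddCommGroup E] [NormedSpace ℝ E]

/-- The distance from `c` to the boundary of `Ω` in the direction `v`. -/
def radialFun (Ω : Set E) (c v : E) : ℝ := (gauge ((fun z => c + z) ⁻¹' Ω) v)⁻¹

theorem gauge_preimage_add_pos {Ω : Set E} (hcomp : IsCompact Ω) {c : E}
    (hc : c ∈ interior Ω) {v : E} (hv : v ≠ 0) : 0 < gauge ((fun z => c + z) ⁻¹' Ω) v := by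
  refine (gauge_pos (absorbent_nhds_zero (preimage_add_mem_nhds_zero hc)) ?_).2 hv
  refine NormedSpace.isVonNBounded_of_isBounded ℝ ?_
  obtain ⟨R, hR⟩ := hcomp.isBounded.subset_closedBall c
  refine (isBounded_closedBall (x := (0 : E)) (r := R)).subset fun z hz => ?_
  simpa using hR hz

theorem radialFun_pos {Ω : Set E} (hcomp : IsCompact Ω) {c : E}
    (hc : c ∈ interior Ω) {v : E} (hv : v ≠ 0) : 0 < radialFun Ω c v :=
  inv_pos.2 (gauge_preimage_add_pos hcomp hc hv)

/-- The translate of `Ω` by `-c` is closed, convex and a neighbourhood of `0`, so it is the set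
where its gauge is at most one. -/
theorem add_smul_mem_iff_le_radialFun {Ω : Set E} (hconv : Convex ℝ Ω) (hcomp : IsCompact Ω) {c : E}
    (hc : c ∈ interior Ω) {v : E} (hv : v ≠ 0) {r : ℝ} (hr : 0 ≤ r) :
    c + r • v ∈ Ω ↔ r ≤ radialFun Ω c v := by
  have hclosed : IsClosed ((fun z => c + z) ⁻¹' Ω) := hcomp.isClosed.preimage (by fun_prop)
  have h := gauge_le_one_iff_mem_closure (hconv.translate_preimage_right c)
    (preimage_add_mem_nhds_zero hc) (x := r • v)
  rw [hclosed.closure_eq, gauge_smul_of_nonneg hr, smul_eq_mul] at h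
  rw [radialFun, ← one_div, le_div_iff₀ (gauge_preimage_add_pos hcomp hc hv), h, mem_preimage]

theorem continuousOn_radialFun {Ω : Set E} (hconv : Convex ℝ Ω) (hcomp : IsCompact Ω) {c : E}
    (hc : c ∈ interior Ω) : ContinuousOn (radialFun Ω c) {0}ᶜ :=
  (continuous_gauge (hconv.translate_preimage_right c)
    (preimage_add_mem_nhds_zero hc)).continuousOn.inv₀
      fun _ hv => (gauge_preimage_add_pos hcomp hc hv).ne'

/-- The convex combination of the two boundary points in direction `v` is again in `Ω`, on the ray
from `s • a + t • b` in direction `v`. -/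
theorem radialFun_concave {Ω : Set E} (hconv : Convex ℝ Ω) (hcomp : IsCompact Ω)
    {a b : E} (ha : a ∈ interior Ω) (hb : b ∈ interior Ω) {s t : ℝ}
    (hs : 0 ≤ s) (ht : 0 ≤ t) (hst : s + t = 1) {v : E} (hv : v ≠ 0) :
    s * radialFun Ω a v + t * radialFun Ω b v ≤ radialFun Ω (s • a + t • b) v := by
  have hra := (radialFun_pos hcomp ha hv).le
  have hrb := (radialFun_pos hcomp hb hv).le
  rw [← add_smul_mem_iff_le_radialFun hconv hcomp (hconv.interior ha hb hs ht hst) hv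
    (by positivity)]
  have h1 := (add_smul_mem_iff_le_radialFun hconv hcomp ha hv hra).2 le_rfl
  have h2 := (add_smul_mem_iff_le_radialFun hconv hcomp hb hv hrb).2 le_rfl
  convert hconv h1 h2 hs ht hst using 1
  simp only [smul_add, add_smul, mul_smul]
  abel

/-- In the direction of an extreme point off the line `ab`, the radial function is strictly
midpoint concave. -/
theorem radialFun_midpoint_lt {Ω : Set E} (hconv : Convex ℝ Ω) (hcomp : IsCompact Ω)
    {a b : E} (ha : a ∈ interior Ω) (hb : b ∈ interior Ω)
    (hab : a ≠ b) {p : E} (hp : p ∈ extremePoints ℝ Ω)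
    (hline : p - ((1 / 2 : ℝ) • a + (1 / 2 : ℝ) • b) ∉ Submodule.span ℝ {b - a}) {v : E} {r : ℝ}
    (hr : 0 < r) (hpv : p = (1 / 2 : ℝ) • a + (1 / 2 : ℝ) • b + r • v) :
    1 / 2 * radialFun Ω a v + 1 / 2 * radialFun Ω b v <
      radialFun Ω ((1 / 2 : ℝ) • a + (1 / 2 : ℝ) • b) v := by
  have hv : v ≠ 0 := by
    rintro rfl
    apply hline
    rw [hpv]
    simp
  have hz := hconv.interior ha hb (a := (1 / 2 : ℝ)) (b := 1 / 2) (by norm_num) (by norm_num)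
    (by norm_num)
  refine (radialFun_concave hconv hcomp ha hb (by norm_num) (by norm_num) (by norm_num)
    hv).lt_of_ne fun heq => ?_
  have hra := radialFun_pos hcomp ha hv
  have hrb := radialFun_pos hcomp hb hv
  set z := (1 / 2 : ℝ) • a + (1 / 2 : ℝ) • b with hzdef
  set ra := radialFun Ω a v
  set rb := radialFun Ω b v
  have hrz : r ≤ radialFun Ω z v :=
    (add_smul_mem_iff_le_radialFun hconv hcomp hz hv hr.le).1 (hpv ▸ hp.1)
  rw [← heq] at hrz
  have key : ∀ q s : ℝ, a + q • v ≠ b + s • v := by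
    intro q s hs
    apply hline
    have h3 : b - a = (q - s) • v := by
      rw [sub_smul, sub_eq_sub_iff_add_eq_add, ← hs, add_comm]
    have h4 : q - s ≠ 0 := fun h0 => hab (by
      rw [h0, zero_smul, sub_eq_zero] at h3
      exact h3.symm)
    rw [hpv, add_sub_cancel_left, Submodule.mem_span_singleton]
    exact ⟨r / (q - s), by rw [h3, smul_smul, div_mul_cancel₀ _ h4]⟩
  -- Under equality `r ≤ (ra + rb) / 2`. Shrinking both chords by this factor makes `p` the midpoint
  -- of two points of `Ω`; extremality identifies them, against `key`.
  have hq : 2 * r / (ra + rb) ≤ 1 := by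
    rw [div_le_one (by positivity)]
    linarith
  have h1 := (add_smul_mem_iff_le_radialFun hconv hcomp ha hv
    (r := 2 * r / (ra + rb) * ra) (by positivity)).2 (mul_le_of_le_one_left hra.le hq)
  have h2 := (add_smul_mem_iff_le_radialFun hconv hcomp hb hv
    (r := 2 * r / (ra + rb) * rb) (by positivity)).2 (mul_le_of_le_one_left hrb.le hq)
  have hseg : p ∈ openSegment ℝ (a + (2 * r / (ra + rb) * ra) • v)
      (b + (2 * r / (ra + rb) * rb) • v) := by
    refine ⟨1 / 2, 1 / 2, by norm_num, by norm_num, by norm_num, ?_⟩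
    have h5 : r = 1 / 2 * (2 * r / (ra + rb) * ra) + 1 / 2 * (2 * r / (ra + rb) * rb) := by
      field_simp
    have h8 : r • v = (1 / 2 : ℝ) • (2 * r / (ra + rb) * ra) • v +
        (1 / 2 : ℝ) • (2 * r / (ra + rb) * rb) • v := by
      rw [smul_smul, smul_smul, ← add_smul, ← h5]
    rw [hpv, hzdef, h8, smul_add, smul_add]
    abel
  obtain ⟨h6, h7⟩ := (mem_extremePoints.1 hp).2 _ h1 _ h2 hseg
  exact key _ _ (h6.trans h7.symm)

/-- Serves in dimension one: it separates the radial values at two distinct points, so that strict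
concavity of the primitive can be used. -/
theorem add_radialFun_le {Ω : Set E} (hconv : Convex ℝ Ω) (hcomp : IsCompact Ω) {a v : E} {s : ℝ}
    (ha : a ∈ interior Ω) (hb : a + s • v ∈ interior Ω) (hs : 0 ≤ s) (hv : v ≠ 0) :
    s + radialFun Ω (a + s • v) v ≤ radialFun Ω a v := by
  have hrb := (radialFun_pos hcomp hb hv).le
  rw [← add_smul_mem_iff_le_radialFun hconv hcomp ha hv (by positivity), add_smul, ← add_assoc]
  exact (add_smul_mem_iff_le_radialFun hconv hcomp hb hv hrb).2 le_rfl

theorem le_radialFun {Ω : Set E} (hconv : Convex ℝ Ω) (hcomp : IsCompact Ω) {c : E} {δ : ℝ}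
    (hδ : 0 < δ) (hδΩ : closedBall c δ ⊆ Ω) {v : E} (hv : ‖v‖ = 1) : δ ≤ radialFun Ω c v := by
  have hc : c ∈ interior Ω := mem_interior_iff_mem_nhds.2
    (mem_of_superset (closedBall_mem_nhds c hδ) hδΩ)
  rw [← add_smul_mem_iff_le_radialFun hconv hcomp hc (norm_ne_zero_iff.1 (by simp [hv])) hδ.le]
  refine hδΩ ?_
  simp [norm_smul, hv, abs_of_pos hδ]

end Radial

/-- A convex body in dimension at least two has an extreme point off a given line. -/
theorem exists_extremePoint_not_mem_line {m : ℕ} (hm : 2 ≤ m) {Ω : Set (EuclideanSpace ℝ (Fin m))}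
    (hconv : Convex ℝ Ω) (hcomp : IsCompact Ω) (hne : (interior Ω).Nonempty)
    (z d : EuclideanSpace ℝ (Fin m)) :
    ∃ p ∈ extremePoints ℝ Ω, p - z ∉ Submodule.span ℝ {d} := by
  by_contra! h
  obtain ⟨y, hy, hyl⟩ := exists_mem_forall_ne_line hm isOpen_interior hne z d
  set L : Set (EuclideanSpace ℝ (Fin m)) :=
    (fun y => y - z) ⁻¹' (Submodule.span ℝ {d} : Submodule ℝ (EuclideanSpace ℝ (Fin m))) with hL
  have hLclosed : IsClosed L :=
    (Submodule.closed_of_finiteDimensional _).preimage (by fun_prop)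
  have hLconv : Convex ℝ L := by
    have := (Submodule.convex (Submodule.span ℝ {d} :
      Submodule ℝ (EuclideanSpace ℝ (Fin m)))).translate_preimage_left (-z)
    simpa only [hL, sub_eq_add_neg] using this
  have hsub : Ω ⊆ L := by
    -- Krein–Milman: if all extreme points lay on the closed convex set `L`, so would `Ω`, against
    -- its interior point off the line.
    rw [← closure_convexHull_extremePoints hcomp hconv]
    exact closure_minimal (convexHull_min (fun p hp => h p hp) hLconv) hLclosed
  exact hyl (hsub (interior_subset hy))

/-! ### The radial primitive -/

/-- The primitive of `t ↦ t ^ (α - 1)` given by `t ^ α / α`, or by the logarithm if `α = 0`. -/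
def radialPrimitive (α t : ℝ) : ℝ := if α = 0 then Real.log t else t ^ α / α

theorem hasDerivAt_radialPrimitive (α : ℝ) {t : ℝ} (ht : 0 < t) :
    HasDerivAt (radialPrimitive α) (t ^ (α - 1)) t := by
  by_cases h : α = 0
  · have : radialPrimitive α = Real.log := by ext; simp [radialPrimitive, h]
    rw [this, h, zero_sub, Real.rpow_neg_one]
    exact Real.hasDerivAt_log ht.ne'
  · have : radialPrimitive α = fun t => t ^ α / α := by ext; simp [radialPrimitive, h]
    rw [this]
    have h1 := (Real.hasDerivAt_rpow_const (p := α) (Or.inl ht.ne')).div_const α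
    rwa [mul_div_cancel_left₀ _ h] at h1

theorem continuousOn_radialPrimitive (α : ℝ) : ContinuousOn (radialPrimitive α) (Ioi 0) :=
  fun _ ht => (hasDerivAt_radialPrimitive α ht).continuousAt.continuousWithinAt

theorem strictMonoOn_radialPrimitive (α : ℝ) : StrictMonoOn (radialPrimitive α) (Ioi 0) := by
  refine strictMonoOn_of_deriv_pos (convex_Ioi 0) (continuousOn_radialPrimitive α) fun t ht => ?_
  rw [interior_Ioi] at ht
  rw [(hasDerivAt_radialPrimitive α ht).deriv]
  exact Real.rpow_pos_of_pos ht _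

/-- The source of the restriction `α ≤ 1`: the derivative `t ^ (α - 1)` must be nonincreasing. -/
theorem concaveOn_radialPrimitive {α : ℝ} (hα : α ≤ 1) :
    ConcaveOn ℝ (Ioi 0) (radialPrimitive α) := by
  refine AntitoneOn.concaveOn_of_deriv (convex_Ioi 0) (continuousOn_radialPrimitive α) ?_ ?_
  · rw [interior_Ioi]
    exact fun t ht => (hasDerivAt_radialPrimitive α ht).differentiableAt.differentiableWithinAt
  · rw [interior_Ioi]
    intro s hs t ht hst
    rw [(hasDerivAt_radialPrimitive α hs).deriv, (hasDerivAt_radialPrimitive α ht).deriv]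
    exact Real.rpow_le_rpow_of_nonpos hs hst (by linarith)

theorem strictConcaveOn_radialPrimitive {α : ℝ} (hα : α < 1) :
    StrictConcaveOn ℝ (Ioi 0) (radialPrimitive α) := by
  refine StrictAntiOn.strictConcaveOn_of_deriv (convex_Ioi 0) (continuousOn_radialPrimitive α) ?_
  rw [interior_Ioi]
  intro s hs t ht hst
  rw [(hasDerivAt_radialPrimitive α hs).deriv, (hasDerivAt_radialPrimitive α ht).deriv]
  exact Real.rpow_lt_rpow_of_neg hs hst (by linarith)

theorem integral_rpow_sub_one (α : ℝ) {ε δ : ℝ} (hε : 0 < ε) (hεδ : ε ≤ δ) :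
    ∫ r in ε..δ, r ^ (α - 1) = radialPrimitive α δ - radialPrimitive α ε := by
  have hpos : ∀ t ∈ uIcc ε δ, 0 < t := fun t ht => by
    rw [uIcc_of_le hεδ] at ht
    exact hε.trans_le ht.1
  refine intervalIntegral.integral_eq_sub_of_hasDerivAt
    (fun t ht => hasDerivAt_radialPrimitive α (hpos t ht)) ?_
  refine ContinuousOn.intervalIntegrable fun t ht => ?_
  exact (Real.continuousAt_rpow_const _ _ (Or.inl (hpos t ht).ne')).continuousWithinAt

theorem integral_rpow_sub_one_of_pos {α : ℝ} (hα : 0 < α) (δ : ℝ) :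
    ∫ r in (0 : ℝ)..δ, r ^ (α - 1) = radialPrimitive α δ := by
  rw [integral_rpow (Or.inl (by linarith)), radialPrimitive, if_neg hα.ne', sub_add_cancel,
    Real.zero_rpow hα.ne', sub_zero]

/-! ### The potential as an integral over the sphere -/

theorem integral_volumeIoiPow (n : ℕ) (f : ℝ → ℝ) :
    ∫ r : Ioi (0 : ℝ), f r ∂(Measure.volumeIoiPow n) = ∫ r in Ioi (0 : ℝ), r ^ n * f r := by
  simp only [Measure.volumeIoiPow, ENNReal.ofReal]
  rw [integral_withDensity_eq_integral_smul
      ((measurable_subtype_coe.pow_const _).real_toNNReal),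
    integral_subtype_comap measurableSet_Ioi fun a => Real.toNNReal (a ^ n) • f a]
  refine setIntegral_congr_fun measurableSet_Ioi fun x hx => ?_
  rw [NNReal.smul_def, Real.coe_toNNReal _ (pow_nonneg (le_of_lt hx) _), smul_eq_mul]

theorem sphere_coe_ne_zero {E : Type*} [NormedAddCommGroup E] (v : sphere (0 : E) 1) :
    (v : E) ≠ 0 := ne_zero_of_mem_unit_sphere v

/-- Polar coordinates centered at an interior point of a convex body. -/
theorem setIntegral_norm_eq_integral_sphere {m : ℕ} (hm : 1 ≤ m)
    {Ω : Set (EuclideanSpace ℝ (Fin m))} (hconv : Convex ℝ Ω) (hcomp : IsCompact Ω)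
    {c : EuclideanSpace ℝ (Fin m)} (hc : c ∈ interior Ω) {h : ℝ → ℝ}
    (hint : IntegrableOn (fun y => h ‖c - y‖) Ω) :
    ∫ y in Ω, h ‖c - y‖ = ∫ v : sphere (0 : EuclideanSpace ℝ (Fin m)) 1,
      (∫ r in (0 : ℝ)..(radialFun Ω c v), r ^ (m - 1) * h r) ∂(unitSphereMeasure m) := by
  have hΩm : MeasurableSet Ω := hcomp.isClosed.measurableSet
  have hint' := ((integrable_indicator_iff hΩm).2 hint).comp_add_left c
  rw [integrable_iff_integrable_sphere_prod hm] at hint'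
  rw [← integral_indicator hΩm, ← integral_add_left_eq_self _ c,
    integral_eq_integral_sphere_prod hm, integral_prod _ hint']
  congr 1 with v
  have hv := sphere_coe_ne_zero v
  have hρ := radialFun_pos hcomp hc hv
  have h1 : ∀ r : Ioi (0 : ℝ), Ω.indicator (fun y => h ‖c - y‖)
      (c + (r : ℝ) • (v : EuclideanSpace ℝ (Fin m))) =
      (Iic (radialFun Ω c v)).indicator h (r : ℝ) := by
    intro r
    have hr : (0 : ℝ) < r := r.2
    have h2 := add_smul_mem_iff_le_radialFun hconv hcomp hc hv hr.le
    by_cases h3 : c + (r : ℝ) • (v : EuclideanSpace ℝ (Fin m)) ∈ Ω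
    · rw [indicator_of_mem h3, indicator_of_mem (by exact h2.1 h3)]
      simp [norm_smul, abs_of_pos hr]
    · rw [indicator_of_notMem h3, indicator_of_notMem (by exact fun h4 => h3 (h2.2 h4))]
  simp only [h1]
  rw [integral_volumeIoiPow (m - 1) ((Iic (radialFun Ω c v)).indicator h),
    intervalIntegral.integral_of_le hρ.le, ← Ioi_inter_Iic, ← setIntegral_indicator measurableSet_Iic]
  congr 1 with r
  by_cases hr : r ∈ Iic (radialFun Ω c v) <;> simp [hr]

/-- The kernel is locally integrable for positive `α`. -/
theorem integrableOn_rpow_norm_sub {m : ℕ} (hm : 1 ≤ m) {Ω : Set (EuclideanSpace ℝ (Fin m))}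
    (hb : Bornology.IsBounded Ω) {α : ℝ} (hα : 0 < α) (c : EuclideanSpace ℝ (Fin m)) :
    IntegrableOn (fun y => ‖c - y‖ ^ (α - m)) Ω := by
  have : Nonempty (Fin m) := ⟨⟨0, hm⟩⟩
  obtain ⟨R, hR⟩ := hb.subset_ball c
  refine IntegrableOn.mono_set ?_ hR
  have h1 : IntegrableOn (fun z : EuclideanSpace ℝ (Fin m) => ‖z‖ ^ (α - m)) (ball 0 R) := by
    rw [integrableOn_fun_norm_addHaar volume (f := fun s : ℝ => s ^ (α - m)),
      finrank_euclideanSpace_fin]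
    rcases le_or_gt R 0 with hR0 | hR0
    · rw [Ioo_eq_empty (not_lt.2 hR0)]
      exact integrableOn_empty
    have h2 : IntegrableOn (fun r : ℝ => r ^ (α - 1)) (Ioo 0 R) :=
      ((intervalIntegral.intervalIntegrable_rpow' (a := 0) (b := R) (r := α - 1)
        (by linarith)).1).mono_set Ioo_subset_Ioc_self
    refine h2.congr_fun (fun r hr => ?_) measurableSet_Ioo
    simp only
    rw [smul_eq_mul, ← Real.rpow_natCast, ← Real.rpow_add hr.1, Nat.cast_sub hm]
    congr 1
    push_cast
    ring
  rw [← integrable_indicator_iff measurableSet_ball] at h1 ⊢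
  refine (h1.comp_sub_left c).congr (Eventually.of_forall fun y => ?_)
  simp only [indicator, mem_ball_iff_norm, sub_zero, norm_sub_rev c y]

/-- Away from the pole the kernel is integrable for every `α ≤ m`. -/
theorem integrableOn_rpow_norm_sub_diff {m : ℕ} {Ω : Set (EuclideanSpace ℝ (Fin m))}
    (hcomp : IsCompact Ω) {α : ℝ} (hα : α ≤ m) (c : EuclideanSpace ℝ (Fin m)) {ε : ℝ}
    (hε : 0 < ε) : IntegrableOn (fun y => ‖c - y‖ ^ (α - m)) (Ω \ closedBall c ε) := by
  have hfin : volume (Ω \ closedBall c ε) < ⊤ :=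
    (measure_mono sdiff_subset).trans_lt hcomp.measure_lt_top
  refine Measure.integrableOn_of_bounded (M := ε ^ (α - m)) hfin.ne
    (Measurable.aestronglyMeasurable (by fun_prop)) ?_
  refine (ae_restrict_iff' (hcomp.isClosed.measurableSet.diff measurableSet_closedBall)).2
    (Eventually.of_forall fun y hy => ?_)
  have hy2 : ε < ‖c - y‖ := by
    have := hy.2
    rw [mem_closedBall, not_le, dist_comm, dist_eq_norm] at this
    exact this
  rw [Real.norm_of_nonneg (by positivity)]
  exact Real.rpow_le_rpow_of_nonpos hε hy2.le (by linarith)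

theorem continuous_radialPrimitive_radialFun {m : ℕ} {Ω : Set (EuclideanSpace ℝ (Fin m))}
    (hconv : Convex ℝ Ω) (hcomp : IsCompact Ω) {c : EuclideanSpace ℝ (Fin m)}
    (hc : c ∈ interior Ω) (α : ℝ) :
    Continuous fun v : sphere (0 : EuclideanSpace ℝ (Fin m)) 1 =>
      radialPrimitive α (radialFun Ω c v) :=
  (continuousOn_radialPrimitive α).comp_continuous
    ((continuousOn_radialFun hconv hcomp hc).comp_continuous continuous_subtype_val
      sphere_coe_ne_zero) fun v => radialFun_pos hcomp hc (sphere_coe_ne_zero v)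

theorem integrable_radialPrimitive_radialFun {m : ℕ} {Ω : Set (EuclideanSpace ℝ (Fin m))}
    (hconv : Convex ℝ Ω) (hcomp : IsCompact Ω) {c : EuclideanSpace ℝ (Fin m)}
    (hc : c ∈ interior Ω) (α : ℝ) :
    Integrable (fun v : sphere (0 : EuclideanSpace ℝ (Fin m)) 1 =>
      radialPrimitive α (radialFun Ω c v)) (unitSphereMeasure m) :=
  (continuous_radialPrimitive_radialFun hconv hcomp hc α).integrable_of_hasCompactSupport
    (HasCompactSupport.of_compactSpace _)

theorem pow_mul_rpow_sub {m : ℕ} (hm : 1 ≤ m) {r : ℝ} (hr : 0 < r) (α : ℝ) :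
    r ^ (m - 1) * r ^ (α - m) = r ^ (α - 1) := by
  rw [← Real.rpow_natCast, ← Real.rpow_add hr, Nat.cast_sub hm]
  congr 1
  push_cast
  ring

/-- The truncated integral in terms of the radial function. -/
theorem setIntegral_diff_closedBall {m : ℕ} (hm : 1 ≤ m) {Ω : Set (EuclideanSpace ℝ (Fin m))}
    (hconv : Convex ℝ Ω) (hcomp : IsCompact Ω) {α : ℝ} (hα : α ≤ m)
    {c : EuclideanSpace ℝ (Fin m)} {ε : ℝ} (hε : 0 < ε) (hεΩ : closedBall c ε ⊆ Ω) :
    ∫ y in Ω \ closedBall c ε, ‖c - y‖ ^ (α - m) =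
      (∫ v : sphere (0 : EuclideanSpace ℝ (Fin m)) 1, radialPrimitive α (radialFun Ω c v)
        ∂(unitSphereMeasure m)) - sphereArea m * radialPrimitive α ε := by
  have hc : c ∈ interior Ω := mem_interior_iff_mem_nhds.2
    (mem_of_superset (closedBall_mem_nhds c hε) hεΩ)
  have hind : ∀ y, (closedBall c ε)ᶜ.indicator (fun y => ‖c - y‖ ^ (α - m)) y =
      (Ioi ε).indicator (fun r : ℝ => r ^ (α - m)) ‖c - y‖ := fun y => by
    simp only [indicator, mem_compl_iff, mem_closedBall, not_le, mem_Ioi, dist_comm y c,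
      dist_eq_norm]
  have hint : IntegrableOn (fun y => (Ioi ε).indicator (fun r : ℝ => r ^ (α - m)) ‖c - y‖) Ω := by
    simp only [← hind]
    rw [IntegrableOn, integrable_indicator_iff measurableSet_closedBall.compl, IntegrableOn,
      Measure.restrict_restrict measurableSet_closedBall.compl, inter_comm, ← sdiff_eq]
    exact integrableOn_rpow_norm_sub_diff hcomp hα c hε
  rw [sdiff_eq, ← setIntegral_indicator measurableSet_closedBall.compl]
  simp only [hind]
  rw [setIntegral_norm_eq_integral_sphere hm hconv hcomp hc hint]
  have hinner : ∀ v : sphere (0 : EuclideanSpace ℝ (Fin m)) 1,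
      ∫ r in (0 : ℝ)..(radialFun Ω c v), r ^ (m - 1) *
        (Ioi ε).indicator (fun r : ℝ => r ^ (α - m)) r =
      radialPrimitive α (radialFun Ω c v) - radialPrimitive α ε := by
    intro v
    have hle := le_radialFun hconv hcomp hε hεΩ (norm_eq_of_mem_sphere v)
    rw [← integral_rpow_sub_one α hε hle, intervalIntegral.integral_of_le (hε.le.trans hle),
      intervalIntegral.integral_of_le hle, ← integral_indicator measurableSet_Ioc,
      ← integral_indicator measurableSet_Ioc]
    congr 1 with r
    by_cases hr : r ∈ Ioc ε (radialFun Ω c v)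
    · rw [indicator_of_mem hr, indicator_of_mem (show r ∈ Ioc 0 _ from ⟨hε.trans hr.1, hr.2⟩),
        indicator_of_mem (show r ∈ Ioi ε from hr.1), pow_mul_rpow_sub hm (hε.trans hr.1)]
    · rw [indicator_of_notMem hr]
      by_cases hr2 : r ∈ Ioc 0 (radialFun Ω c v)
      · rw [indicator_of_mem hr2, indicator_of_notMem (s := Ioi ε) (fun h => hr ⟨h, hr2.2⟩), mul_zero]
      · rw [indicator_of_notMem hr2]
  simp only [hinner]
  rw [integral_sub (integrable_radialPrimitive_radialFun hconv hcomp hc α) (integrable_const _),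
    integral_const, smul_eq_mul, sphereArea]

/-- The potential at an interior point of a convex body, for `α < m`. -/
theorem potential_eq_integral_sphere {m : ℕ} (hm : 1 ≤ m) {Ω : Set (EuclideanSpace ℝ (Fin m))}
    (hconv : Convex ℝ Ω) (hcomp : IsCompact Ω) {α : ℝ} (hα : α < m)
    {c : EuclideanSpace ℝ (Fin m)} (hc : c ∈ interior Ω) :
    potential Ω α c = ∫ v : sphere (0 : EuclideanSpace ℝ (Fin m)) 1,
      radialPrimitive α (radialFun Ω c v) ∂(unitSphereMeasure m) := by
  by_cases h0 : 0 < α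
  · rw [potential, if_pos h0, if_neg hα.ne, Real.sign_of_pos (by linarith), one_mul,
      setIntegral_norm_eq_integral_sphere hm hconv hcomp hc (h := fun r => r ^ (α - m))
        (integrableOn_rpow_norm_sub hm hcomp.isBounded h0 c)]
    congr 1 with v
    have hρ := radialFun_pos hcomp hc (sphere_coe_ne_zero v)
    rw [← integral_rpow_sub_one_of_pos h0, intervalIntegral.integral_of_le hρ.le,
      intervalIntegral.integral_of_le hρ.le]
    exact setIntegral_congr_fun measurableSet_Ioc fun r hr => pow_mul_rpow_sub hm hr.1 α
  · obtain ⟨δ, hδ, hδΩ⟩ := Metric.nhds_basis_closedBall.mem_iff.1 (mem_interior_iff_mem_nhds.1 hc)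
    rw [potential, if_neg h0, if_pos hc]
    -- The subtracted divergent term is exactly `-sphereArea m * radialPrimitive α ε`, so the
    -- truncated quantity is already constant for `ε ≤ δ`.
    refine Tendsto.limUnder_eq (tendsto_const_nhds.congr' ?_)
    filter_upwards [Ioc_mem_nhdsGT hδ] with ε hε
    rw [truncated, setIntegral_diff_closedBall hm hconv hcomp hα.le hε.1
      ((closedBall_subset_closedBall hε.2).trans hδΩ), radialPrimitive]
    by_cases h1 : α = 0
    · rw [if_pos h1, if_pos h1, one_div, Real.log_inv]
      ring
    · rw [if_neg h1, if_neg h1, Real.rpow_neg hε.1.le]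
      field_simp
      ring

theorem potential_eq_setIntegral_diff_add {m : ℕ} (hm : 1 ≤ m)
    {Ω : Set (EuclideanSpace ℝ (Fin m))} (hconv : Convex ℝ Ω) (hcomp : IsCompact Ω) {α : ℝ}
    (hα : α < m) {c : EuclideanSpace ℝ (Fin m)} {δ : ℝ} (hδ : 0 < δ)
    (hδΩ : closedBall c δ ⊆ Ω) :
    potential Ω α c = (∫ y in Ω \ closedBall c δ, ‖c - y‖ ^ (α - m)) +
      sphereArea m * radialPrimitive α δ := by
  have hc : c ∈ interior Ω := mem_interior_iff_mem_nhds.2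
    (mem_of_superset (closedBall_mem_nhds c hδ) hδΩ)
  rw [potential_eq_integral_sphere hm hconv hcomp hα hc,
    setIntegral_diff_closedBall hm hconv hcomp hα.le hδ hδΩ, sub_add_cancel]

/-! ### Concavity of the potential -/

/-- Integrates over directions an increasing concave function of the concave radial function. -/
theorem potential_concave {m : ℕ} (hm : 1 ≤ m) {Ω : Set (EuclideanSpace ℝ (Fin m))}
    (hconv : Convex ℝ Ω) (hcomp : IsCompact Ω) {α : ℝ} (hα1 : α ≤ 1) (hα : α < m) :
    ConcaveOn ℝ (interior Ω) (potential Ω α) := by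
  refine ⟨hconv.interior, fun a ha b hb s t hs ht hst => ?_⟩
  have hz := hconv.interior ha hb hs ht hst
  rw [potential_eq_integral_sphere hm hconv hcomp hα ha,
    potential_eq_integral_sphere hm hconv hcomp hα hb,
    potential_eq_integral_sphere hm hconv hcomp hα hz, smul_eq_mul, smul_eq_mul,
    ← integral_const_mul, ← integral_const_mul, ← integral_add
      ((integrable_radialPrimitive_radialFun hconv hcomp ha α).const_mul _)
      ((integrable_radialPrimitive_radialFun hconv hcomp hb α).const_mul _)]
  refine integral_mono
      (((integrable_radialPrimitive_radialFun hconv hcomp ha α).const_mul _).add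
      ((integrable_radialPrimitive_radialFun hconv hcomp hb α).const_mul _))
      (integrable_radialPrimitive_radialFun hconv hcomp hz α) fun v => ?_
  have hv := sphere_coe_ne_zero v
  have hra := radialFun_pos hcomp ha hv
  have hrb := radialFun_pos hcomp hb hv
  exact ((concaveOn_radialPrimitive hα1).2 hra hrb hs ht hst).trans
    ((strictMonoOn_radialPrimitive α).monotoneOn ((convex_Ioi 0) hra hrb hs ht hst)
      (radialFun_pos hcomp hz hv) (radialFun_concave hconv hcomp ha hb hs ht hst hv))

theorem potential_midpoint_lt {m : ℕ} (hm : 1 ≤ m) {Ω : Set (EuclideanSpace ℝ (Fin m))}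
    (hconv : Convex ℝ Ω) (hcomp : IsCompact Ω) {α : ℝ} (hα1 : α ≤ 1) (hα : α < m)
    {a b : EuclideanSpace ℝ (Fin m)} (ha : a ∈ interior Ω) (hb : b ∈ interior Ω) (hab : a ≠ b) :
    1 / 2 * potential Ω α a + 1 / 2 * potential Ω α b <
      potential Ω α ((1 / 2 : ℝ) • a + (1 / 2 : ℝ) • b) := by
  have hz := hconv.interior ha hb (a := (1 / 2 : ℝ)) (b := 1 / 2) (by norm_num) (by norm_num)
    (by norm_num)
  have half_pos : (0 : ℝ) < 1 / 2 := by norm_num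
  have half_add : (1 / 2 : ℝ) + 1 / 2 = 1 := by norm_num
  have hFa := (integrable_radialPrimitive_radialFun hconv hcomp ha α).const_mul (1 / 2)
  have hFb := (integrable_radialPrimitive_radialFun hconv hcomp hb α).const_mul (1 / 2)
  have hFz := integrable_radialPrimitive_radialFun hconv hcomp hz α
  rw [potential_eq_integral_sphere hm hconv hcomp hα ha,
    potential_eq_integral_sphere hm hconv hcomp hα hb,
    potential_eq_integral_sphere hm hconv hcomp hα hz,
    ← integral_const_mul, ← integral_const_mul, ← integral_add hFa hFb]
  set z := (1 / 2 : ℝ) • a + (1 / 2 : ℝ) • b with hzdef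
  have hle : ∀ v : sphere (0 : EuclideanSpace ℝ (Fin m)) 1,
      1 / 2 * radialPrimitive α (radialFun Ω a v) + 1 / 2 * radialPrimitive α (radialFun Ω b v) ≤
        radialPrimitive α (1 / 2 * radialFun Ω a v + 1 / 2 * radialFun Ω b v) := fun v => by
    have hv := sphere_coe_ne_zero v
    simpa only [smul_eq_mul] using (concaveOn_radialPrimitive hα1).2 (radialFun_pos hcomp ha hv)
      (radialFun_pos hcomp hb hv) half_pos.le half_pos.le half_add
  have hle2 : ∀ v : sphere (0 : EuclideanSpace ℝ (Fin m)) 1,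
      radialPrimitive α (1 / 2 * radialFun Ω a v + 1 / 2 * radialFun Ω b v) ≤
        radialPrimitive α (radialFun Ω z v) := fun v => by
    have hv := sphere_coe_ne_zero v
    have hra := radialFun_pos hcomp ha hv
    have hrb := radialFun_pos hcomp hb hv
    exact (strictMonoOn_radialPrimitive α).monotoneOn (by simp only [mem_Ioi]; positivity)
      (radialFun_pos hcomp hz hv)
      (radialFun_concave hconv hcomp ha hb (by norm_num) (by norm_num) (by norm_num) hv)
  -- By continuity in `v`, strictness in one direction holds on an open set of directions, which has
  -- positive measure.
  suffices hex : ∃ v : sphere (0 : EuclideanSpace ℝ (Fin m)) 1,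
      1 / 2 * radialPrimitive α (radialFun Ω a v) + 1 / 2 * radialPrimitive α (radialFun Ω b v) <
        radialPrimitive α (radialFun Ω z v) by
    set T := {v : sphere (0 : EuclideanSpace ℝ (Fin m)) 1 |
        1 / 2 * radialPrimitive α (radialFun Ω a v) + 1 / 2 * radialPrimitive α (radialFun Ω b v) <
          radialPrimitive α (radialFun Ω z v)} with hT
    have hopen : IsOpen T :=
      isOpen_lt (((continuous_radialPrimitive_radialFun hconv hcomp ha α).const_mul _).add
        ((continuous_radialPrimitive_radialFun hconv hcomp hb α).const_mul _))
        (continuous_radialPrimitive_radialFun hconv hcomp hz α)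
    have hTpos : 0 < unitSphereMeasure m (T ∩ univ) := by
      rw [inter_univ]
      exact hopen.measure_pos _ hex
    rw [← setIntegral_univ, ← setIntegral_univ (f := fun v : sphere _ 1 => radialPrimitive α _)]
    exact setIntegral_lt_setIntegral MeasurableSet.univ (hFa.add hFb).integrableOn
      hFz.integrableOn (fun v _ => (hle v).trans (hle2 v)) hTpos fun v hv => hv.1
  -- For `m ≥ 2` (where `α = 1` may occur) strictness comes from the radial function, towards an
  -- extreme point off the line `ab`. For `m = 1` one has `α < 1`, and it comes from strict
  -- concavity of the primitive.
  by_cases hm2 : 2 ≤ m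
  · obtain ⟨p, hp, hpl⟩ := exists_extremePoint_not_mem_line hm2 hconv hcomp ⟨a, ha⟩ z (b - a)
    have hpz : 0 < ‖p - z‖ := norm_pos_iff.2 fun h0 => hpl (by rw [h0]; exact zero_mem _)
    let v : sphere (0 : EuclideanSpace ℝ (Fin m)) 1 :=
      ⟨‖p - z‖⁻¹ • (p - z), by simp [norm_smul, hpz.ne']⟩
    refine ⟨v, (hle v).trans_lt ?_⟩
    have hv := sphere_coe_ne_zero v
    have hra := radialFun_pos hcomp ha hv
    have hrb := radialFun_pos hcomp hb hv
    refine strictMonoOn_radialPrimitive α (by simp only [mem_Ioi]; positivity)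
      (radialFun_pos hcomp hz hv) ?_
    refine radialFun_midpoint_lt hconv hcomp ha hb hab hp hpl hpz ?_
    simp only [v]
    rw [smul_inv_smul₀ hpz.ne', add_sub_cancel]
  · have hα' : α < 1 := by
      have : m = 1 := by omega
      simpa [this] using hα
    have hd : 0 < ‖b - a‖ := norm_pos_iff.2 (sub_ne_zero.2 hab.symm)
    let v : sphere (0 : EuclideanSpace ℝ (Fin m)) 1 :=
      ⟨‖b - a‖⁻¹ • (b - a), by simp [norm_smul, hd.ne']⟩
    have hv := sphere_coe_ne_zero v
    have hb' : b = a + ‖b - a‖ • (v : EuclideanSpace ℝ (Fin m)) := by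
      simp only [v]
      rw [smul_inv_smul₀ hd.ne', add_sub_cancel]
    have hρ := add_radialFun_le hconv hcomp ha (hb' ▸ hb) hd.le hv
    rw [← hb'] at hρ
    refine ⟨v, lt_of_lt_of_le ?_ (hle2 v)⟩
    simpa only [smul_eq_mul] using (strictConcaveOn_radialPrimitive hα').2
      (radialFun_pos hcomp ha hv) (radialFun_pos hcomp hb hv) (by linarith) half_pos half_pos
      half_add

/-! ### The balance point is critical -/

/-- The balance point of a convex body is an interior point. -/
theorem BalanceLaw.mem_interior {m : ℕ} (hm : 1 ≤ m) {Ω : Set (EuclideanSpace ℝ (Fin m))}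
    (hΩ : IsBody Ω) (hconv : Convex ℝ Ω) {x : EuclideanSpace ℝ (Fin m)} (hx : BalanceLaw Ω x) :
    x ∈ interior Ω := by
  by_contra hxi
  -- Otherwise `f (y - x)` would be negative throughout the interior, while the balance law with
  -- weight `1` makes its integral zero.
  obtain ⟨f, hf⟩ := geometric_hahn_banach_open_point hconv.interior isOpen_interior hxi
  have h := hx.integral_radial_smul hm hΩ.measurableSet (fun _ => 1)
  simp only [one_smul] at h
  have hint : IntegrableOn (fun y => y - x) Ω := hΩ.integrableOn (by fun_prop)
  have h2 := f.integral_comp_comm hint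
  rw [h, map_zero] at h2
  have hle : ∀ y ∈ Ω, f y ≤ f x := fun y hy =>
    closure_minimal (fun z hz => (hf z hz).le) (isClosed_le f.continuous continuous_const)
      (hΩ.subset_closure_interior hy)
  have hlt := setIntegral_lt_setIntegral hΩ.measurableSet (f.integrable_comp hint)
    (integrableOn_zero : IntegrableOn (fun _ => (0 : ℝ)) Ω) (t := interior Ω)
    (fun y hy => by rw [map_sub]; linarith [hle y hy])
    (by rw [inter_eq_self_of_subset_left interior_subset]
        exact isOpen_interior.measure_pos _ hΩ.interior_nonempty)
    (fun y hy => by rw [map_sub]; linarith [hf y hy.1])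
  rw [h2] at hlt
  simp at hlt

/-- The kernel cut off inside the ball of radius `δ` gives the potential up to a constant. -/
theorem exists_potential_eq_setIntegral_max {m : ℕ} (hm : 1 ≤ m)
    {Ω : Set (EuclideanSpace ℝ (Fin m))} (hconv : Convex ℝ Ω) (hcomp : IsCompact Ω) {α : ℝ}
    (hα : α < m) {δ : ℝ} (hδ : 0 < δ) :
    ∃ C : ℝ, ∀ c, closedBall c δ ⊆ Ω →
      potential Ω α c = (∫ y in Ω, (max ‖c - y‖ δ) ^ (α - m)) + C := by
  -- On the ball the cut-off kernel is the constant `δ ^ (α - m)`; the difference between this and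
  -- the finite part of the true kernel there is the same for every center `c`.
  refine ⟨sphereArea m * radialPrimitive α δ - volume.real
    (closedBall (0 : EuclideanSpace ℝ (Fin m)) δ) * δ ^ (α - m), fun c hc => ?_⟩
  rw [potential_eq_setIntegral_diff_add hm hconv hcomp hα hδ hc]
  have hcont : Continuous fun y => (max ‖c - y‖ δ) ^ (α - m) := by
    refine Continuous.rpow_const (by fun_prop) fun y => Or.inl ?_
    exact (hδ.trans_le (le_max_right _ _)).ne'
  have h1 : ∫ y in Ω \ closedBall c δ, (max ‖c - y‖ δ) ^ (α - m) =
      ∫ y in Ω \ closedBall c δ, ‖c - y‖ ^ (α - m) := by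
    refine setIntegral_congr_fun (hcomp.isClosed.measurableSet.diff measurableSet_closedBall)
      fun y hy => ?_
    have := hy.2
    rw [mem_closedBall, not_le, dist_comm, dist_eq_norm] at this
    simp only [max_eq_left this.le]
  have h2 : ∫ y in closedBall c δ, (max ‖c - y‖ δ) ^ (α - m) =
      volume.real (closedBall (0 : EuclideanSpace ℝ (Fin m)) δ) * δ ^ (α - m) := by
    rw [setIntegral_congr_fun (g := fun _ => δ ^ (α - m)) measurableSet_closedBall,
      setIntegral_const, smul_eq_mul, measureReal_def, Measure.addHaar_closedBall_center,
      ← measureReal_def]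
    intro y hy
    rw [mem_closedBall, dist_comm, dist_eq_norm] at hy
    simp only [max_eq_right hy]
  have hU : Ω = (Ω \ closedBall c δ) ∪ closedBall c δ := (sdiff_union_of_subset hc).symm
  have hint : IntegrableOn (fun y => (max ‖c - y‖ δ) ^ (α - m)) Ω :=
    hcont.continuousOn.integrableOn_compact hcomp
  have h3 : ∫ y in Ω, (max ‖c - y‖ δ) ^ (α - m) =
      (∫ y in Ω \ closedBall c δ, (max ‖c - y‖ δ) ^ (α - m)) +
        ∫ y in closedBall c δ, (max ‖c - y‖ δ) ^ (α - m) := by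
    conv_lhs => rw [hU]
    exact setIntegral_union disjoint_sdiff_left measurableSet_closedBall
      (hint.mono_set sdiff_subset) (hint.mono_set hc)
  rw [h3, h1, h2]
  ring

/-- On `[δ, ∞)` the derivative of `s ^ p` is largest in absolute value at `δ`. This gives the
Lipschitz bound for differentiating under the integral. -/
theorem abs_max_rpow_sub_le {p δ : ℝ} (hp : p ≤ 1) (hδ : 0 < δ) (s t : ℝ) :
    |(max s δ) ^ p - (max t δ) ^ p| ≤ |p| * δ ^ (p - 1) * |s - t| := by
  have h : ‖(max s δ) ^ p - (max t δ) ^ p‖ ≤ |p| * δ ^ (p - 1) * ‖max s δ - max t δ‖ := by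
    refine Convex.norm_image_sub_le_of_norm_hasDerivWithin_le (f := fun s : ℝ => s ^ p)
      (f' := fun s => p * s ^ (p - 1)) (s := Ici δ)
      (fun r hr => (Real.hasDerivAt_rpow_const (Or.inl (hδ.trans_le hr).ne')).hasDerivWithinAt)
      (fun r hr => ?_) (convex_Ici δ) (mem_Ici.2 (le_max_right _ _))
      (mem_Ici.2 (le_max_right _ _))
    have hr0 : 0 < r := hδ.trans_le hr
    rw [norm_mul, Real.norm_eq_abs, Real.norm_of_nonneg (by positivity : 0 ≤ r ^ (p - 1))]
    exact mul_le_mul_of_nonneg_left (Real.rpow_le_rpow_of_nonpos hδ hr (by linarith)) (abs_nonneg p)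
  refine h.trans ?_
  gcongr
  exact abs_max_sub_max_le_abs _ _ _

theorem hasDerivAt_rpow_norm_add_smul {E : Type*} [NormedAddCommGroup E] [InnerProductSpace ℝ E]
    {a : E} (ha : a ≠ 0) (d : E) (p : ℝ) :
    HasDerivAt (fun t : ℝ => ‖a + t • d‖ ^ p) (p * ‖a‖ ^ (p - 2) * inner ℝ a d) 0 := by
  have h1 : HasDerivAt (fun t : ℝ => a + t • d) d 0 := by
    simpa using ((hasDerivAt_id (0 : ℝ)).smul_const d).const_add a
  have h2 := h1.norm_sq
  simp only [zero_smul, add_zero] at h2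
  have ha' : 0 < ‖a‖ := norm_pos_iff.2 ha
  have h3 := h2.rpow_const (p := p / 2) (Or.inl (by simp [ha]))
  simp only [zero_smul, add_zero] at h3
  have h4 : ∀ z : E, ∀ q : ℝ, (‖z‖ ^ 2) ^ q = ‖z‖ ^ (2 * q) := fun z q => by
    rw [← Real.rpow_two, ← Real.rpow_mul (norm_nonneg _)]
  simp only [h4] at h3
  convert h3 using 1
  · ext t
    congr 1
    ring
  · rw [show 2 * (p / 2 - 1) = p - 2 by ring]
    ring

/-- The cut-off potential has a critical point at the balance point. -/
theorem BalanceLaw.hasDerivAt_setIntegral_max {m : ℕ} (hm : 1 ≤ m)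
    {Ω : Set (EuclideanSpace ℝ (Fin m))} (hΩ : IsBody Ω) {x : EuclideanSpace ℝ (Fin m)}
    (hx : BalanceLaw Ω x) {p : ℝ} (hp : p ≤ 1) {δ : ℝ} (hδ : 0 < δ)
    (d : EuclideanSpace ℝ (Fin m)) :
    HasDerivAt (fun t : ℝ => ∫ y in Ω, (max ‖x + t • d - y‖ δ) ^ p) 0 0 := by
  have : Nonempty (Fin m) := ⟨⟨0, hm⟩⟩
  have hcont : ∀ t : ℝ, Continuous fun y => (max ‖x + t • d - y‖ δ) ^ p := fun t => by
    refine Continuous.rpow_const (by fun_prop) fun y => Or.inl ?_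
    exact (hδ.trans_le (le_max_right _ _)).ne'
  -- The radial weight in the derivative of the cut-off kernel: zero inside the ball, and outside
  -- with a sign because the weight multiplies `y - x` instead of `x - y`.
  set g : ℝ → ℝ := (Ioi δ).indicator fun s => -p * s ^ (p - 2) with hg
  have hgm : Measurable g := Measurable.indicator (by fun_prop) measurableSet_Ioi
  have hgb : ∀ s, ‖g s‖ ≤ |p| * δ ^ (p - 2) := fun s => by
    by_cases hs : s ∈ Ioi δ
    · have hs0 : 0 < s := hδ.trans hs
      rw [hg, indicator_of_mem hs, norm_mul, norm_neg, Real.norm_eq_abs,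
        Real.norm_of_nonneg (by positivity)]
      exact mul_le_mul_of_nonneg_left (Real.rpow_le_rpow_of_nonpos hδ (le_of_lt hs) (by linarith))
        (abs_nonneg p)
    · rw [hg, indicator_of_notMem hs, norm_zero]
      positivity
  have hgi : IntegrableOn (fun y => g ‖y - x‖ • (y - x)) Ω :=
    Integrable.bdd_smul (C := |p| * δ ^ (p - 2))
      (hΩ.integrableOn (f := fun y => y - x) (by fun_prop))
      (hgm.comp (by fun_prop : Measurable fun y => ‖y - x‖)).aestronglyMeasurable
      (Eventually.of_forall fun y => hgb _)
  have h0 := hx.integral_radial_inner hm hΩ.measurableSet g d hgi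
  suffices h : HasDerivAt (fun t : ℝ => ∫ y in Ω, (max ‖x + t • d - y‖ δ) ^ p)
      (∫ y in Ω, g ‖y - x‖ * inner ℝ (y - x) d) 0 by rwa [h0] at h
  refine (hasDerivAt_integral_of_dominated_loc_of_lip (s := univ)
    (bound := fun _ => |p| * δ ^ (p - 1) * ‖d‖) univ_mem
    (Eventually.of_forall fun t => (hcont t).aestronglyMeasurable) (hΩ.integrableOn (hcont 0))
    ?_ ?_ ?_ ?_).2
  · refine AEStronglyMeasurable.mul
      (hgm.comp (by fun_prop : Measurable fun y => ‖y - x‖)).aestronglyMeasurable ?_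
    exact Continuous.aestronglyMeasurable (by fun_prop)
  · refine Eventually.of_forall fun y => LipschitzOnWith.of_dist_le_mul fun s _ t _ => ?_
    rw [Real.dist_eq, Real.coe_nnabs, Real.dist_eq,
      abs_of_nonneg (by positivity : 0 ≤ |p| * δ ^ (p - 1) * ‖d‖)]
    refine (abs_max_rpow_sub_le hp hδ _ _).trans ?_
    rw [mul_assoc (|p| * _)]
    gcongr
    refine (abs_norm_sub_norm_le _ _).trans (le_of_eq ?_)
    rw [sub_sub_sub_cancel_right, add_sub_add_left_eq_sub, ← sub_smul, norm_smul, mul_comm,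
      Real.norm_eq_abs]
  · exact hΩ.integrableOn continuous_const
  · have hsph : ∀ᵐ y ∂(volume.restrict Ω), y ∉ sphere x δ :=
      -- The cut-off kernel may fail to be differentiable where `‖y - x‖ = δ`; this sphere is null.
      ae_restrict_of_ae (measure_eq_zero_iff_ae_notMem.1 (Measure.addHaar_sphere volume x δ))
    filter_upwards [hsph] with y hy
    rw [mem_sphere, dist_eq_norm] at hy
    have hnorm : Tendsto (fun t : ℝ => ‖x + t • d - y‖) (𝓝 0) (𝓝 ‖y - x‖) := by
      have hc : Continuous fun t : ℝ => ‖x + t • d - y‖ := by fun_prop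
      simpa [norm_sub_rev] using hc.tendsto 0
    rcases lt_or_gt_of_ne hy with hlt | hgt
    · rw [hg, indicator_of_notMem (by simpa using hlt.le), zero_mul]
      refine (hasDerivAt_const (0 : ℝ) (δ ^ p)).congr_of_eventuallyEq ?_
      filter_upwards [hnorm.eventually (gt_mem_nhds hlt)] with t ht
      rw [max_eq_right ht.le]
    · rw [hg, indicator_of_mem (by exact hgt)]
      have h := hasDerivAt_rpow_norm_add_smul (a := x - y)
        (sub_ne_zero.2 fun h => by simp [h] at hgt; linarith) d p
      have h5 : -p * ‖y - x‖ ^ (p - 2) * inner ℝ (y - x) d =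
          p * ‖x - y‖ ^ (p - 2) * inner ℝ (x - y) d := by
        rw [norm_sub_rev, ← neg_sub x y, inner_neg_left]
        ring
      rw [h5]
      refine h.congr_of_eventuallyEq ?_
      filter_upwards [hnorm.eventually (lt_mem_nhds hgt)] with t ht
      rw [max_eq_left ht.le, sub_add_eq_add_sub]

/-- The potential at interior points of a convex body is at most that at the balance point. -/
theorem potential_le_of_mem_interior {m : ℕ} (hm : 1 ≤ m) {Ω : Set (EuclideanSpace ℝ (Fin m))}
    (hΩ : IsBody Ω) (hconv : Convex ℝ Ω) {x : EuclideanSpace ℝ (Fin m)} (hx : BalanceLaw Ω x)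
    {α : ℝ} (hα1 : α ≤ 1) (hα : α < m) {c : EuclideanSpace ℝ (Fin m)} (hc : c ∈ interior Ω) :
    potential Ω α c ≤ potential Ω α x := by
  have hxi := hx.mem_interior hm hΩ hconv
  obtain ⟨η, hη, hηΩ⟩ := Metric.nhds_basis_closedBall.mem_iff.1 (mem_interior_iff_mem_nhds.1 hxi)
  -- Half the radius keeps the cut-off ball inside `Ω` when its center moves by up to `η / 2`.
  have hδ : 0 < η / 2 := by positivity
  obtain ⟨C, hC⟩ := exists_potential_eq_setIntegral_max hm hconv hΩ.isCompact hα hδ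
  set φ : ℝ → ℝ := fun t => ∫ y in Ω, (max ‖x + t • (c - x) - y‖ (η / 2)) ^ (α - m) with hφ
  have hderiv : HasDerivAt φ 0 0 :=
    hx.hasDerivAt_setIntegral_max hm hΩ (by linarith) hδ (c - x)
  have hlim := hderiv.tendsto_slope_zero_right
  rw [← sub_nonpos]
  -- By concavity the slope from `x` towards `c` is at least the difference of the potentials at `c`
  -- and `x`, and it tends to `0`.
  refine ge_of_tendsto hlim ?_
  have hball : ∀ᶠ t : ℝ in 𝓝[>] 0, x + t • (c - x) ∈ closedBall x (η / 2) := by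
    have hcont : Continuous fun t : ℝ => x + t • (c - x) := by fun_prop
    have h1 : Tendsto (fun t : ℝ => x + t • (c - x)) (𝓝[>] 0) (𝓝 x) := by
      simpa using (hcont.tendsto 0).mono_left nhdsWithin_le_nhds
    exact h1.eventually (closedBall_mem_nhds x hδ)
  filter_upwards [hball, Ioo_mem_nhdsGT one_pos] with t ht ht1
  have hsub : closedBall (x + t • (c - x)) (η / 2) ⊆ Ω := by
    refine (closedBall_subset_closedBall' ?_).trans hηΩ
    rw [mem_closedBall] at ht
    linarith
  have hV := hC _ hsub
  have hV0 := hC x ((closedBall_subset_closedBall (by linarith)).trans hηΩ)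
  have hconc := (potential_concave hm hconv hΩ.isCompact hα1 hα).2 hxi hc
    (sub_nonneg.2 ht1.2.le) ht1.1.le (sub_add_cancel 1 t)
  have hpt : (1 - t) • x + t • c = x + t • (c - x) := by
    rw [sub_smul, one_smul, smul_sub]
    abel
  rw [hpt, smul_eq_mul, smul_eq_mul] at hconc
  have hφ0 : φ 0 = ∫ y in Ω, (max ‖x - y‖ (η / 2)) ^ (α - m) := by simp [hφ]
  rw [zero_add, smul_eq_mul, ← div_eq_inv_mul, le_div_iff₀ ht1.1, hφ0]
  have hφt : φ t = potential Ω α (x + t • (c - x)) - C := by rw [hV]; ring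
  rw [hφt]
  nlinarith

/-- The balance point is the only maximum point of the potential in the interior. -/
theorem potential_lt_of_mem_interior_of_convex {m : ℕ} (hm : 1 ≤ m)
    {Ω : Set (EuclideanSpace ℝ (Fin m))} (hΩ : IsBody Ω) (hconv : Convex ℝ Ω)
    {x : EuclideanSpace ℝ (Fin m)} (hx : BalanceLaw Ω x) {α : ℝ} (hα1 : α ≤ 1) (hα : α < m)
    {c : EuclideanSpace ℝ (Fin m)} (hc : c ∈ interior Ω) (hcx : c ≠ x) :
    potential Ω α c < potential Ω α x := by
  have hxi := hx.mem_interior hm hΩ hconv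
  have h1 := potential_midpoint_lt hm hconv hΩ.isCompact hα1 hα hc hxi hcx
  have h2 := potential_le_of_mem_interior hm hΩ hconv hx hα1 hα
    (hconv.interior hc hxi (a := (1 / 2 : ℝ)) (b := 1 / 2) (by norm_num) (by norm_num)
      (by norm_num))
  linarith

/-! ### Points outside the interior, for positive `α` -/

theorem potential_of_pos {m : ℕ} (Ω : Set (EuclideanSpace ℝ (Fin m))) {α : ℝ} (h0 : 0 < α)
    (hα : α < m) (c : EuclideanSpace ℝ (Fin m)) :
    potential Ω α c = ∫ y in Ω, ‖c - y‖ ^ (α - m) := by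
  rw [potential, if_pos h0, if_neg hα.ne, Real.sign_of_pos (by linarith), one_mul]

/-- For positive `α` the potential is lower semicontinuous along sequences. -/
theorem potential_le_of_tendsto {m : ℕ} (hm : 1 ≤ m) {Ω : Set (EuclideanSpace ℝ (Fin m))}
    (hcomp : IsCompact Ω) {α : ℝ} (h0 : 0 < α) (hα : α < m) {u : ℕ → EuclideanSpace ℝ (Fin m)}
    {c : EuclideanSpace ℝ (Fin m)} (hu : Tendsto u atTop (𝓝 c)) {L : ℝ}
    (hL : ∀ n, potential Ω α (u n) ≤ L) : potential Ω α c ≤ L := by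
  have : Nonempty (Fin m) := ⟨⟨0, hm⟩⟩
  have hof : ∀ z : EuclideanSpace ℝ (Fin m), ENNReal.ofReal (potential Ω α z) =
      ∫⁻ y in Ω, ENNReal.ofReal (‖z - y‖ ^ (α - m)) := fun z => by
    rw [potential_of_pos Ω h0 hα, ofReal_integral_eq_lintegral_ofReal
      (integrableOn_rpow_norm_sub hm hcomp.isBounded h0 z)
      (Eventually.of_forall fun y => by positivity)]
  have hL0 : 0 ≤ L := by
    refine le_trans ?_ (hL 0)
    rw [potential_of_pos Ω h0 hα]
    exact integral_nonneg fun y => by positivity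
  rw [← ENNReal.ofReal_le_ofReal_iff hL0, hof]
  have hae : ∀ᵐ y ∂(volume.restrict Ω), ENNReal.ofReal (‖c - y‖ ^ (α - m)) =
      liminf (fun n => ENNReal.ofReal (‖u n - y‖ ^ (α - m))) atTop := by
    have hne : ∀ᵐ y ∂(volume.restrict Ω), y ∉ ({c} : Set (EuclideanSpace ℝ (Fin m))) :=
      ae_restrict_of_ae (measure_eq_zero_iff_ae_notMem.1 (measure_singleton c))
    filter_upwards [hne] with y hy
    refine (Tendsto.liminf_eq ?_).symm
    refine (ENNReal.continuous_ofReal.tendsto _).comp ?_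
    have hcy : ‖c - y‖ ≠ 0 := norm_ne_zero_iff.2 (sub_ne_zero.2 fun h => hy h.symm)
    exact (hu.sub_const y).norm.rpow_const (Or.inl hcy)
  calc ∫⁻ y in Ω, ENNReal.ofReal (‖c - y‖ ^ (α - m))
      = ∫⁻ y in Ω, liminf (fun n => ENNReal.ofReal (‖u n - y‖ ^ (α - m))) atTop :=
        lintegral_congr_ae hae
    _ ≤ liminf (fun n => ∫⁻ y in Ω, ENNReal.ofReal (‖u n - y‖ ^ (α - m))) atTop :=
        lintegral_liminf_le fun n => by fun_prop
    _ ≤ liminf (fun _ : ℕ => ENNReal.ofReal L) atTop := by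
        refine liminf_le_liminf (Eventually.of_forall fun n => ?_)
        rw [← hof]
        exact ENNReal.ofReal_le_ofReal (hL n)
    _ = ENNReal.ofReal L := liminf_const _

/-- For `c` on the boundary, concavity on the segment from `x` to interior points near `c` keeps
their potentials below the maximum by a fixed amount, and semicontinuity carries the gap to `c`. -/
theorem potential_lt_of_mem {m : ℕ} (hm : 1 ≤ m) {Ω : Set (EuclideanSpace ℝ (Fin m))}
    (hΩ : IsBody Ω) (hconv : Convex ℝ Ω) {x : EuclideanSpace ℝ (Fin m)} (hx : BalanceLaw Ω x)
    {α : ℝ} (h0 : 0 < α) (hα1 : α ≤ 1) (hα : α < m) {c : EuclideanSpace ℝ (Fin m)} (hc : c ∈ Ω)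
    (hcx : c ≠ x) : potential Ω α c < potential Ω α x := by
  have hxi := hx.mem_interior hm hΩ hconv
  have hint : ∀ s : ℝ, 0 < s → s ≤ 1 → s • x + (1 - s) • c ∈ interior Ω := fun s h1 h2 =>
    hconv.combo_interior_self_mem_interior hxi hc h1 (by linarith) (by ring)
  have hzi := hint (1 / 2) (by norm_num) (by norm_num)
  set z := (1 / 2 : ℝ) • x + (1 - 1 / 2 : ℝ) • c with hz
  have hzx : z ≠ x := by
    intro h
    apply hcx
    have h2 : (1 / 2 : ℝ) • (c - x) = 0 := by
      rw [← sub_eq_zero] at h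
      rw [← h, hz]
      module
    simpa [sub_eq_zero] using h2
  have hzlt := potential_lt_of_mem_interior_of_convex hm hΩ hconv hx hα1 hα hzi hzx
  set u : ℕ → EuclideanSpace ℝ (Fin m) :=
    fun n => (1 / ((n : ℝ) + 1) / 4) • x + (1 - 1 / ((n : ℝ) + 1) / 4) • c with hu
  have hulim : Tendsto u atTop (𝓝 c) := by
    have h1 := (tendsto_one_div_add_atTop_nhds_zero_nat (𝕜 := ℝ)).div_const 4
    have h2 := (h1.smul_const x).add ((h1.const_sub 1).smul_const c)
    rwa [zero_div, zero_smul, zero_add, sub_zero, one_smul] at h2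
  -- With `z = (1 - l) • x + l • u n`, concavity bounds the drop at `u n` below by `1 / l` times the
  -- drop at `z`; the weights `s ≤ 1 / 4` give `l ≤ 2 / 3`, hence the factor `3 / 2`.
  refine (potential_le_of_tendsto hm hΩ.isCompact h0 hα hulim
    (L := potential Ω α x - 3 / 2 * (potential Ω α x - potential Ω α z)) fun n => ?_).trans_lt
    (by linarith)
  have hs0 : 0 < 1 / ((n : ℝ) + 1) / 4 := by positivity
  have hs1 : 1 / ((n : ℝ) + 1) / 4 ≤ 1 / 4 := by
    have : 1 / ((n : ℝ) + 1) ≤ 1 := by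
      rw [div_le_one (by positivity)]
      have : (0 : ℝ) ≤ n := n.cast_nonneg
      linarith
    linarith
  have hui := hint _ hs0 (hs1.trans (by norm_num))
  change u n ∈ interior Ω at hui
  have hun : u n = (1 / ((n : ℝ) + 1) / 4) • x + (1 - 1 / ((n : ℝ) + 1) / 4) • c := rfl
  set s := 1 / ((n : ℝ) + 1) / 4 with hs
  have hs2 : 0 < 1 - s := by linarith
  set l := 1 / (2 * (1 - s)) with hl
  have hl0 : 0 ≤ l := by positivity
  have hll : l * (1 - s) = 1 / 2 := by rw [hl]; field_simp
  have hl1 : l ≤ 1 := by nlinarith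
  have hl2 : l ≤ 2 / 3 := by nlinarith
  have hconc := (potential_concave hm hconv hΩ.isCompact hα1 hα).2 hxi hui
    (sub_nonneg.2 hl1) hl0 (sub_add_cancel 1 l)
  have hpt : (1 - l) • x + l • u n = z := by
    rw [hun, hz, smul_add, smul_smul, smul_smul, hll, ← add_assoc, ← add_smul]
    congr 2
    · linarith
    · norm_num
  rw [hpt, smul_eq_mul, smul_eq_mul] at hconc
  by_contra! hcon
  nlinarith

/-- The point `q` is the metric projection of `c` onto `Ω`, whose obtuse-angle property gives the
inequality; an interior point cannot be the projection of an outside point. -/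
theorem exists_mem_forall_norm_sub_le {E : Type*} [NormedAddCommGroup E] [InnerProductSpace ℝ E]
    [CompleteSpace E] {Ω : Set E} (hconv : Convex ℝ Ω) (hclosed : IsClosed Ω) {x : E}
    (hxi : x ∈ interior Ω) {c : E} (hc : c ∉ Ω) :
    ∃ q ∈ Ω, q ≠ x ∧ ∀ y ∈ Ω, ‖q - y‖ ≤ ‖c - y‖ := by
  obtain ⟨q, hq, hqe⟩ := exists_norm_eq_iInf_of_complete_convex ⟨x, interior_subset hxi⟩
    hclosed.isComplete hconv c
  have hq2 := (norm_eq_iInf_iff_real_inner_le_zero hconv hq).1 hqe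
  refine ⟨q, hq, ?_, fun y hy => ?_⟩
  · rintro rfl
    have ht : Tendsto (fun t : ℝ => q + t • (c - q)) (𝓝[>] 0) (𝓝 q) := by
      have : Continuous fun t : ℝ => q + t • (c - q) := by fun_prop
      simpa using (this.tendsto 0).mono_left nhdsWithin_le_nhds
    obtain ⟨t, ht1, ht2⟩ := ((ht.eventually (isOpen_interior.mem_nhds hxi)).and
      (Ioo_mem_nhdsGT one_pos)).exists
    have h := hq2 _ (interior_subset ht1)
    rw [add_sub_cancel_left, inner_smul_right, real_inner_self_eq_norm_sq] at h
    have hd : 0 < ‖c - q‖ := norm_pos_iff.2 (sub_ne_zero.2 fun h => hc (h ▸ hq))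
    have : 0 < t * ‖c - q‖ ^ 2 := by
      have := ht2.1
      positivity
    linarith
  · have h := hq2 y hy
    have h2 : ‖c - y‖ ^ 2 = ‖c - q‖ ^ 2 - 2 * inner ℝ (c - q) (y - q) + ‖q - y‖ ^ 2 := by
      rw [norm_sub_rev q y, ← norm_sub_sq_real, sub_sub_sub_cancel_right]
    refine le_of_sq_le_sq ?_ (norm_nonneg _)
    nlinarith [sq_nonneg ‖c - q‖]

/-- As `α < m`, the kernel decreases with distance, so projecting an outside point onto `Ω` does not
lower the potential. -/
theorem potential_lt_of_pos {m : ℕ} (hm : 1 ≤ m) {Ω : Set (EuclideanSpace ℝ (Fin m))}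
    (hΩ : IsBody Ω) (hconv : Convex ℝ Ω) {x : EuclideanSpace ℝ (Fin m)} (hx : BalanceLaw Ω x)
    {α : ℝ} (h0 : 0 < α) (hα1 : α ≤ 1) (hα : α < m) {c : EuclideanSpace ℝ (Fin m)}
    (hcx : c ≠ x) : potential Ω α c < potential Ω α x := by
  by_cases hc : c ∈ Ω
  · exact potential_lt_of_mem hm hΩ hconv hx h0 hα1 hα hc hcx
  have : Nonempty (Fin m) := ⟨⟨0, hm⟩⟩
  obtain ⟨q, hq, hqx, hqy⟩ := exists_mem_forall_norm_sub_le hconv hΩ.isCompact.isClosed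
    (hx.mem_interior hm hΩ hconv) hc
  refine lt_of_le_of_lt ?_ (potential_lt_of_mem hm hΩ hconv hx h0 hα1 hα hq hqx)
  rw [potential_of_pos Ω h0 hα, potential_of_pos Ω h0 hα]
  have hne : ∀ᵐ y, y ∉ ({q} : Set (EuclideanSpace ℝ (Fin m))) :=
    measure_eq_zero_iff_ae_notMem.1 (measure_singleton q)
  refine setIntegral_mono_on_ae (integrableOn_rpow_norm_sub hm hΩ.isCompact.isBounded h0 c)
    (integrableOn_rpow_norm_sub hm hΩ.isCompact.isBounded h0 q) hΩ.measurableSet ?_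
  filter_upwards [hne] with y hy hyΩ
  exact Real.rpow_le_rpow_of_nonpos
    (norm_pos_iff.2 (sub_ne_zero.2 fun h => hy h.symm)) (hqy y hyΩ) (by linarith)

/-! ### The logarithmic potential on the line -/

/-- A convex body on the line satisfying the balance law is an interval around the balance point. -/
theorem BalanceLaw.exists_eq_closedBall {Ω : Set (EuclideanSpace ℝ (Fin 1))} (hΩ : IsBody Ω)
    (hconv : Convex ℝ Ω) {x : EuclideanSpace ℝ (Fin 1)} (hx : BalanceLaw Ω x) :
    ∃ R : ℝ, 0 < R ∧ Ω = closedBall x R := by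
  have hxi := hx.mem_interior le_rfl hΩ hconv
  obtain ⟨w, hw, hwmax⟩ := hΩ.isCompact.exists_isMaxOn ⟨x, interior_subset hxi⟩
    (f := fun y => ‖x - y‖) (by fun_prop)
  have hsub : Ω ⊆ closedBall x ‖x - w‖ := fun y hy => by
    rw [mem_closedBall, dist_comm, dist_eq_norm]
    exact hwmax hy
  have hR : 0 < ‖x - w‖ := by
    refine (norm_nonneg _).lt_of_ne fun h0 => ?_
    rw [← h0, closedBall_zero] at hsub
    exact hΩ.volume_pos.ne' (measure_mono_null hsub (measure_singleton x))
  have hwx : w - x ≠ 0 := by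
    rw [← norm_pos_iff, norm_sub_rev]
    exact hR
  refine ⟨_, hR, hsub.antisymm ?_⟩
  rw [← closure_ball x hR.ne']
  refine closure_minimal (fun y hy => ?_) hΩ.isCompact.isClosed
  obtain ⟨t, ht⟩ := exists_smul_eq_of_finrank_eq_one (K := ℝ) (by simp) hwx (y - x)
  have hnorm : ∀ s : ℝ, ‖s • (w - x)‖ = |s| * ‖x - w‖ := fun s => by
    rw [norm_smul, Real.norm_eq_abs, norm_sub_rev w x]
  have ht1 : |t| < 1 := by
    rw [mem_ball, dist_eq_norm, ← ht, hnorm] at hy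
    exact lt_of_mul_lt_mul_right (by rwa [one_mul]) hR.le
  rw [abs_lt] at ht1
  -- In the coordinate with `x` at `0` and `w` at `1`, a point `s` of `Ω` has `|s| ≤ 1`. Being
  -- farther than `1` from `1 + t` then forces `s < t`, so `y` at `t` lies between `z` and `w`.
  obtain ⟨z, hz, hzlt⟩ := exists_norm_lt le_rfl hΩ hx (c := x + (1 + t) • (w - x))
    (by simpa [hwx] using fun h : 1 + t = 0 => by linarith) hw
  obtain ⟨s, hs⟩ := exists_smul_eq_of_finrank_eq_one (K := ℝ) (by simp) hwx (z - x)
  have hz2 : x + (1 + t) • (w - x) - z = (1 + t - s) • (w - x) := by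
    rw [sub_smul, hs]
    abel
  have hs1 : |s| ≤ 1 := by
    have := hsub hz
    rw [mem_closedBall, dist_eq_norm, ← hs, hnorm] at this
    exact le_of_mul_le_mul_right (by rwa [one_mul]) hR
  have hs2 : 1 < |1 + t - s| := by
    rw [hz2, hnorm] at hzlt
    exact lt_of_mul_lt_mul_right (by rwa [one_mul]) hR.le
  rw [abs_le] at hs1
  have hst : s < t := by
    rcases lt_abs.1 hs2 with h | h <;> linarith
  have hs3 : 0 < 1 - s := by linarith
  have hcomb := hconv hz hw (a := (1 - t) / (1 - s)) (b := (t - s) / (1 - s))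
    (div_nonneg (by linarith) hs3.le) (div_nonneg (by linarith) hs3.le)
    (by rw [← add_div, div_eq_one_iff_eq hs3.ne']; ring)
  convert hcomb using 1
  have hy2 : y = x + t • (w - x) := by rw [ht]; abel
  have hz3 : z = x + s • (w - x) := by rw [hs]; abel
  have hw3 : w = x + (1 : ℝ) • (w - x) := by rw [one_smul]; abel
  have hcoef : t = (1 - t) / (1 - s) * s + (t - s) / (1 - s) * 1 := by
    field_simp
    ring
  have hone : (1 : ℝ) = (1 - t) / (1 - s) + (t - s) / (1 - s) := by
    rw [← add_div, eq_comm, div_eq_one_iff_eq hs3.ne']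
    ring
  calc y = (1 : ℝ) • x + t • (w - x) := by rw [one_smul, hy2]
    _ = ((1 - t) / (1 - s) + (t - s) / (1 - s)) • x +
        ((1 - t) / (1 - s) * s + (t - s) / (1 - s) * 1) • (w - x) := by rw [← hone, ← hcoef]
    _ = ((1 - t) / (1 - s)) • (x + s • (w - x)) + ((t - s) / (1 - s)) • (x + (1 : ℝ) • (w - x)) := by
      module
    _ = _ := by rw [← hz3, ← hw3]

theorem integrableOn_log_norm_sub {Ω : Set (EuclideanSpace ℝ (Fin 1))}
    (hb : Bornology.IsBounded Ω) (c : EuclideanSpace ℝ (Fin 1)) :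
    IntegrableOn (fun y => Real.log ‖c - y‖) Ω := by
  obtain ⟨R, hR⟩ := hb.subset_ball c
  refine IntegrableOn.mono_set ?_ hR
  have h1 : IntegrableOn (fun z : EuclideanSpace ℝ (Fin 1) => Real.log ‖z‖) (ball 0 R) := by
    rw [integrableOn_fun_norm_addHaar volume (f := Real.log), finrank_euclideanSpace_fin]
    simpa using (intervalIntegral.intervalIntegrable_log' (a := 0) (b := R)).1.mono_set
      Ioo_subset_Ioc_self
  rw [← integrable_indicator_iff measurableSet_ball] at h1 ⊢
  refine (h1.comp_sub_left c).congr (Eventually.of_forall fun y => ?_)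
  simp only [indicator, mem_ball_iff_norm, sub_zero, norm_sub_rev c y]

/-- The integral of the logarithm of the distance over an interval is smallest at its center. -/
theorem setIntegral_log_lt {x c : EuclideanSpace ℝ (Fin 1)} {R : ℝ} (hR : 0 < R) (hc : c ≠ x) :
    ∫ y in closedBall x R, Real.log ‖x - y‖ < ∫ y in closedBall x R, Real.log ‖c - y‖ := by
  -- A translation fixes the pole at `x` and moves the interval instead, from center `x` to center
  -- `z`.
  set z := x + (x - c) with hz
  have hshift : ∫ y in closedBall x R, Real.log ‖c - y‖ =
      ∫ y in closedBall z R, Real.log ‖x - y‖ := by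
    rw [← integral_indicator measurableSet_closedBall, ← integral_indicator measurableSet_closedBall,
      ← integral_add_right_eq_self ((closedBall x R).indicator _) (c - x)]
    congr 1 with y
    have h1 : c - (y + (c - x)) = x - y := by abel
    have h2 : y + (c - x) - x = y - z := by rw [hz]; abel
    simp only [indicator, mem_closedBall, dist_eq_norm, h1, h2]
  -- The two intervals have equal length, so subtracting `log R` changes both integrals equally. It
  -- makes the integrand nonpositive almost everywhere on `A` and positive off `A`, so only `A \ B`
  -- and `B \ A` have to be compared.
  set f : EuclideanSpace ℝ (Fin 1) → ℝ := fun y => Real.log ‖x - y‖ - Real.log R with hf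
  have hfi : ∀ s : Set (EuclideanSpace ℝ (Fin 1)), Bornology.IsBounded s → IntegrableOn f s :=
    fun s hs => (integrableOn_log_norm_sub hs x).sub (integrableOn_const (hs.measure_lt_top.ne))
  have hconst : ∀ u : EuclideanSpace ℝ (Fin 1), ∫ y in closedBall u R, f y =
      (∫ y in closedBall u R, Real.log ‖x - y‖) -
        volume.real (closedBall (0 : EuclideanSpace ℝ (Fin 1)) R) * Real.log R := fun u => by
    rw [integral_sub (integrableOn_log_norm_sub isBounded_closedBall x)
      (integrableOn_const measure_closedBall_lt_top.ne), setIntegral_const, smul_eq_mul,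
      measureReal_def, Measure.addHaar_closedBall_center, ← measureReal_def]
  suffices h : ∫ y in closedBall x R, f y < ∫ y in closedBall z R, f y by
    rw [hshift]
    rw [hconst, hconst] at h
    linarith
  set A := closedBall x R with hA
  set B := closedBall z R with hB
  have hAm : MeasurableSet A := measurableSet_closedBall
  have hBm : MeasurableSet B := measurableSet_closedBall
  have hsplitA := integral_inter_add_sdiff hBm (hfi A isBounded_closedBall)
  have hsplitB := integral_inter_add_sdiff hAm (hfi B isBounded_closedBall)
  have hneg : ∫ y in A \ B, f y ≤ 0 := by
    have hne : ∀ᵐ y, y ∉ ({x} : Set (EuclideanSpace ℝ (Fin 1))) :=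
      measure_eq_zero_iff_ae_notMem.1 (measure_singleton x)
    refine setIntegral_nonpos_of_ae_restrict ?_
    rw [EventuallyLE, ae_restrict_iff' (hAm.diff hBm)]
    filter_upwards [hne] with y hy hyA
    have h1 := hyA.1
    rw [hA, mem_closedBall, dist_comm, dist_eq_norm] at h1
    have h2 : 0 < ‖x - y‖ := norm_pos_iff.2 (sub_ne_zero.2 fun h => hy h.symm)
    exact sub_nonpos.2 (Real.log_le_log h2 h1)
  have hfpos : ∀ y ∈ B \ A, 0 < f y := fun y hy => by
    have h1 := hy.2
    rw [hA, mem_closedBall, dist_comm, dist_eq_norm, not_le] at h1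
    exact sub_pos.2 (Real.log_lt_log hR h1)
  have hd : 0 < ‖x - c‖ := norm_pos_iff.2 (sub_ne_zero.2 hc.symm)
  have hvol : 0 < volume (B \ A) := by
    refine (((isOpen_ball (x := z) (ε := R)).inter
      (isClosed_closedBall (x := x) (ε := R)).isOpen_compl).measure_pos volume ?_).trans_le
      (measure_mono fun y hy => ⟨ball_subset_closedBall hy.1, hy.2⟩)
    -- Chosen so that the point at distance `r` beyond `z` is within `R` of `z` but at distance `r +
    -- ‖x - c‖ > R` from `x`.
    set r := max 0 (R - ‖x - c‖ / 2) with hr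
    have hrR : r < R := max_lt hR (by linarith)
    have hr0 : 0 ≤ r := le_max_left _ _
    have hrd : R < r + ‖x - c‖ := by
      have := le_max_right 0 (R - ‖x - c‖ / 2)
      linarith
    refine ⟨z + (r / ‖x - c‖) • (x - c), ?_, ?_⟩
    · rw [mem_ball, dist_eq_norm, add_sub_cancel_left, norm_smul, norm_div, norm_norm,
        div_mul_cancel₀ _ hd.ne', Real.norm_of_nonneg hr0]
      exact hrR
    · have : z + (r / ‖x - c‖) • (x - c) - x = (1 + r / ‖x - c‖) • (x - c) := by
        rw [hz, add_smul, one_smul]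
        abel
      rw [mem_compl_iff, mem_closedBall, dist_eq_norm, this, norm_smul,
        Real.norm_of_nonneg (by positivity), add_mul, div_mul_cancel₀ _ hd.ne', one_mul]
      linarith
  have hpos := setIntegral_lt_setIntegral (hBm.diff hAm)
    (integrableOn_zero : IntegrableOn (fun _ => (0 : ℝ)) (B \ A))
    ((hfi B isBounded_closedBall).mono_set sdiff_subset) (t := univ)
    (fun y hy => (hfpos y hy).le) (by rwa [univ_inter]) (fun y hy => hfpos y hy.2)
  rw [integral_zero] at hpos
  rw [inter_comm] at hsplitB
  linarith

theorem potential_lt_of_dim_one {Ω : Set (EuclideanSpace ℝ (Fin 1))} (hΩ : IsBody Ω)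
    (hconv : Convex ℝ Ω) {x : EuclideanSpace ℝ (Fin 1)} (hx : BalanceLaw Ω x)
    {c : EuclideanSpace ℝ (Fin 1)} (hc : c ≠ x) : potential Ω 1 c < potential Ω 1 x := by
  obtain ⟨R, hR, rfl⟩ := hx.exists_eq_closedBall hΩ hconv
  simp only [potential, zero_lt_one, if_true, Nat.cast_one]
  exact neg_lt_neg (setIntegral_log_lt hR hc)

/-! ### Centers -/

theorem isMaxOn_univ_iff_eq {X : Type*} {f : X → ℝ} {x : X} (h : ∀ c, c ≠ x → f c < f x) (c : X) :
    IsMaxOn f univ c ↔ c = x := by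
  constructor
  · intro hc
    by_contra hne
    exact (h c hne).not_ge (hc (mem_univ x))
  · rintro rfl y -
    by_cases hy : y = c
    · exact hy ▸ le_refl (f y)
    · exact (h y hy).le

theorem isCenter_top_iff {m : ℕ} (hm : 1 ≤ m) {Ω : Set (EuclideanSpace ℝ (Fin m))}
    (hΩ : IsBody Ω) {x : EuclideanSpace ℝ (Fin m)} (hx : BalanceLaw Ω x)
    (c : EuclideanSpace ℝ (Fin m)) : IsCenter Ω ⊤ c ↔ c = x :=
  isCircumcenter_iff hm hΩ hx c

theorem isCenter_coe_iff_of_pos {m : ℕ} {Ω : Set (EuclideanSpace ℝ (Fin m))} {α : ℝ}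
    (hα : 0 < α) {x : EuclideanSpace ℝ (Fin m)}
    (h : ∀ c, c ≠ x → potential Ω α c < potential Ω α x) (c : EuclideanSpace ℝ (Fin m)) :
    IsCenter Ω (α : WithTop ℝ) c ↔ c = x := by
  change (if 0 < α then IsMaxOn (potential Ω α) univ c
    else c ∈ interior Ω ∧ IsMaxOn (potential Ω α) (interior Ω) c) ↔ c = x
  rw [if_pos hα]
  exact isMaxOn_univ_iff_eq h c

theorem isCenter_coe_iff_of_nonpos {m : ℕ} {Ω : Set (EuclideanSpace ℝ (Fin m))} {α : ℝ}
    (hα : α ≤ 0) {x : EuclideanSpace ℝ (Fin m)} (hx : x ∈ interior Ω)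
    (h : ∀ c ∈ interior Ω, c ≠ x → potential Ω α c < potential Ω α x)
    (c : EuclideanSpace ℝ (Fin m)) :
    IsCenter Ω (α : WithTop ℝ) c ↔ c = x := by
  change (if 0 < α then IsMaxOn (potential Ω α) univ c
    else c ∈ interior Ω ∧ IsMaxOn (potential Ω α) (interior Ω) c) ↔ c = x
  rw [if_neg (not_lt.2 hα)]
  constructor
  · rintro ⟨hc, hmax⟩
    by_contra hne
    exact (h c hc hne).not_ge (hmax hx)
  · rintro rfl
    refine ⟨hx, fun y hy => ?_⟩
    by_cases hyc : y = c
    · exact hyc ▸ le_refl (potential Ω α y)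
    · exact (h y hy hyc).le

/-- The sphere formula requires `α < m`; with `α ≤ 1 ≤ m` the only exception is `α = m = 1`, the
logarithmic potential. -/
theorem isCenter_coe_iff_of_convex {m : ℕ} (hm : 1 ≤ m) {Ω : Set (EuclideanSpace ℝ (Fin m))}
    (hΩ : IsBody Ω) (hconv : Convex ℝ Ω) {x : EuclideanSpace ℝ (Fin m)} (hx : BalanceLaw Ω x)
    {α : ℝ} (hα : α ≤ 1) (c : EuclideanSpace ℝ (Fin m)) :
    IsCenter Ω (α : WithTop ℝ) c ↔ c = x := by
  by_cases hαm : α < m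
  · rcases le_or_gt α 0 with h0 | h0
    · exact isCenter_coe_iff_of_nonpos h0 (hx.mem_interior hm hΩ hconv)
        (fun c hc hcx => potential_lt_of_mem_interior_of_convex hm hΩ hconv hx hα hαm hc hcx) c
    · exact isCenter_coe_iff_of_pos h0
        (fun c hcx => potential_lt_of_pos hm hΩ hconv hx h0 hα hαm hcx) c
  · have hm' : (1 : ℝ) ≤ m := by exact_mod_cast hm
    have h1 : α = 1 := by linarith
    have hm1 : m = 1 := by
      have : (m : ℝ) ≤ 1 := by linarith
      exact le_antisymm (by exact_mod_cast this) hm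
    subst h1 hm1
    exact isCenter_coe_iff_of_pos one_pos
      (fun c hcx => potential_lt_of_dim_one hΩ hconv hx hcx) c

end RadialCenter

end

/-! ### Assembly of the cases -/

theorem mainTheorem5 (m : ℕ) (hm : 1 ≤ m) (Ω : Set (EuclideanSpace ℝ (Fin m)))
    (hΩ : RadialCenter.IsBody Ω) (x : EuclideanSpace ℝ (Fin m))
    (hx : RadialCenter.BalanceLaw Ω x) :
    ((∀ α : WithTop ℝ,
        (m = 1 ∧ ((2 : ℝ) : WithTop ℝ) < α) ∨ (2 ≤ m ∧ ((m + 1 : ℝ) : WithTop ℝ) ≤ α) →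
          ∀ c, RadialCenter.IsCenter Ω α c ↔ c = x) ∧
      RadialCenter.centroid Ω = x ∧
      (∀ c, RadialCenter.IsCircumcenter Ω c ↔ c = x)) ∧
    (Convex ℝ Ω →
      ∀ α : WithTop ℝ, α ≤ ((1 : ℝ) : WithTop ℝ) ∨ ((m + 1 : ℝ) : WithTop ℝ) ≤ α →
        ∀ c, RadialCenter.IsCenter Ω α c ↔ c = x) := by
  have hm' : (1 : ℝ) ≤ m := by exact_mod_cast hm
  refine ⟨⟨fun α hα c => ?_, RadialCenter.centroid_eq hm hΩ hx,
    RadialCenter.isCircumcenter_iff hm hΩ hx⟩, fun hconv α hα c => ?_⟩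
  · induction α using WithTop.recTopCoe with
    | top => exact RadialCenter.isCenter_top_iff hm hΩ hx c
    | coe a =>
      rw [WithTop.coe_lt_coe, WithTop.coe_le_coe] at hα
      rcases hα with ⟨h1, h2⟩ | ⟨h1, h2⟩
      · refine RadialCenter.isCenter_coe_iff_of_pos (by linarith) (fun c hc =>
          RadialCenter.potential_lt_of_dim_add_one_lt hm hΩ hx ?_ hc) c
        rw [h1]
        norm_num
        exact h2
      · exact RadialCenter.isCenter_coe_iff_of_pos (by linarith) (fun c hc =>
          RadialCenter.potential_lt_of_dim_add_one_le h1 hΩ hx h2 hc) c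
  · induction α using WithTop.recTopCoe with
    | top => exact RadialCenter.isCenter_top_iff hm hΩ hx c
    | coe a =>
      rw [WithTop.coe_le_coe, WithTop.coe_le_coe] at hα
      rcases hα with h | h
      · exact RadialCenter.isCenter_coe_iff_of_convex hm hΩ hconv hx h c
      · exact RadialCenter.isCenter_coe_iff_of_pos (by linarith) (fun c hc =>
          RadialCenter.potential_lt_of_mem_interior hm hΩ hx (hx.mem_interior hm hΩ hconv) h hc) c
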